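/- Let $B$ be a fractional Brownian motion with Hurst exponent $H\in(0,1)$ (a centred Gaussian process on $\mathbb R$ with almost surely continuous paths and covariance $\frac12(|s|^{2H}+|t|^{2H}-|s-t|^{2H})$), and let $\psi:\mathbb R\to\mathbb R$ be a wavelet, with $\psi(t)$ and $t\psi(t)$ integrable and $\int\psi=0$. The non-decimated wavelet coefficient of $B$ at level $j$ and location $s$ is $\int B(t)\,2^{j/2}\psi(2^j(t-s))\,dt$. Let $\sigma^2>0$ be the variance of the coefficient at level $0$ and put $\lambda_j=\sigma^2 2^{-(2H+1)j}$. Let $N$ (the sample size) and $M\ge1$ (the number of groups) run through a sequence of positive integers with $2M\mid N$ and $N/(2M)\to\infty$; $M$ may be fixed or vary with $N$, and $J$ is fixed. For each member of the sequence let $d_{j,k}$ ($1\le j\le J$, $1\le k\le N$) be wavelet coefficients, each $d_{j,k}$ having the distribution of the level-$j$ coefficient of $B$ at the $k$-th point of the sampling grid, and let $D_{j,k}=(d_{j,k}^2+d_{j,k+N/2}^2)/2$ for $1\le k\le N/2$ be the mid-energies. Assume that $d_{j,k}$ and $d_{j,k+N/2}$ are independent, and that the $n=N/(2M)$ members of each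 group $D(i,j)=\{D_{j,i},D_{j,i+M},\dots,D_{j,N/2-M+i}\}$, $1\le i\le M$, are independent. For a sample of size $n$ let $Y_p$ be its $\lfloor np\rfloor$-th smallest value. Let $\hat\mu^T_{j,i}$ and $\hat\mu^G_{j,i}$ be Tukey's trimean and the Gastwirth estimator of the group $D(i,j)$, that is, the general trimean $\frac\alpha2Y_p+(1-\alpha)Y_{1/2}+\frac\alpha2Y_{1-p}$ with $\alpha=\frac12,p=\frac14$ and with $\alpha=0.6,p=\frac13$, respectively. Then, for all $1\le j\le J$ and all choices of groups $1\le i\le M$, both are asymptotically normal as $N/(2M)\to\infty$, $$\hat\mu^T_{j,i}\approx\mathcal N\Bigl(c_1\lambda_j,\tfrac{5M}{3N}\lambda_j^2\Bigr),\qquad \hat\mu^G_{j,i}\approx\mathcal N\Bigl(c_2\lambda_j,\tfrac{1.67M}{N}\lambda_j^2\Bigr),$$ in the sense that, after subtracting the stated mean and dividing by the square root of the stated variance, they converge in distribution to $\mathcal N(0,1)$; here $c_1=\frac14\log\frac{64}3$ and $c_2=0.3\log\frac92+0.4\log2$ do not depend on $j$. Moreover, if $J\ge2$, the Hurst exponent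 can be estimated by $\hat H^T=-\bar\beta^T/2-1/2$ and by $\hat H^G=-\bar\beta^G/2-1/2$: both converge to $H$ in probability. Here $\bar\beta^T$ and $\bar\beta^G$ are the averages over $i=1,\dots,M$ of the slopes of the least squares regression lines on the pairs $(j,\log_2\hat\mu^T_{j,i})$ and $(j,\log_2\hat\mu^G_{j,i})$, $j=1,\dots,J$, respectively. -/

import Mathlib

open MeasureTheory ProbabilityTheory Filter Topology

noncomputable section

/-- `B` is a (two-sided) fractional Brownian motion with Hurst exponent `H` on `(Ω, P)`: a centred
Gaussian process with almost surely continuous paths and covariance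
`(|s|^{2H} + |t|^{2H} - |s - t|^{2H}) / 2`. -/
structure IsFractionalBrownianMotion {Ω : Type*} [MeasurableSpace Ω] (H : ℝ) (B : ℝ → Ω → ℝ)
    (P : Measure Ω) : Prop where
  isGaussianProcess : IsGaussianProcess B P
  mean_eq_zero : ∀ t, ∫ ω, B t ω ∂P = 0
  covariance_eq : ∀ s t, covariance (B s) (B t) P =
    (|s| ^ (2 * H) + |t| ^ (2 * H) - |s - t| ^ (2 * H)) / 2
  continuous_paths : ∀ᵐ ω ∂P, Continuous fun t => B t ω

/-- The non-decimated wavelet coefficient of the process `B` at level `j` and location `s`, that is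
the integral of `B` against the dilated and translated wavelet `t ↦ 2^{j/2} ψ(2^j (t - s))`.
(Non-decimated: the grid of locations is the same at every level.) -/
def ndwtCoeff {Ω : Type*} (ψ : ℝ → ℝ) (B : ℝ → Ω → ℝ) (j : ℕ) (s : ℝ) (ω : Ω) : ℝ :=
  ∫ t, B t ω * ((2 : ℝ) ^ ((j : ℝ) / 2) * ψ ((2 : ℝ) ^ j * (t - s)))

/-- `λ_j = σ² 2^{-(2H+1)j}`. -/
def levelScale (H σ : ℝ) (j : ℕ) : ℝ := σ ^ 2 * (2 : ℝ) ^ (-(2 * H + 1) * (j : ℝ))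

/-- The mid-energy `D_{j,k} = (d_{j,k}² + d_{j,k+N/2}²) / 2` for an array `d` of wavelet coefficients
with `N` coefficients on each level. -/
def midEnergy {Ω : Type*} (N : ℕ) (d : ℕ → ℕ → Ω → ℝ) (j k : ℕ) (ω : Ω) : ℝ :=
  ((d j k ω) ^ 2 + (d j (k + N / 2) ω) ^ 2) / 2

/-- The `i`-th of the `M` groups of mid-energies at level `j`,
`D_{j,i}, D_{j,i+M}, …, D_{j,N/2-M+i}`; it has `(N/2)/M = N/(2M)` members. -/
def midEnergyGroup {Ω : Type*} (N M : ℕ) (d : ℕ → ℕ → Ω → ℝ) (j i : ℕ) (l : Fin (N / (2 * M)))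
    (ω : Ω) : ℝ :=
  midEnergy N d j (i + l * M) ω

/-- The order statistic `x_{k:n}`, the `k`-th smallest of `x_0, …, x_{n-1}` for `1 ≤ k ≤ n`
(and `0` for other `k`). -/
def orderStat {n : ℕ} (x : Fin n → ℝ) (k : ℕ) : ℝ :=
  if h : 1 ≤ k ∧ k ≤ n then x (Tuple.sort x ⟨k - 1, by omega⟩) else 0

/-- The sample `p`-quantile `Y_p = x_{⌊np⌋:n}`. -/
def sampleQuantile {n : ℕ} (x : Fin n → ℝ) (p : ℝ) : ℝ := orderStat x ⌊(n : ℝ) * p⌋₊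

/-- The general trimean estimator
`(α/2) Y_p + (1 - α) Y_{1/2} + (α/2) Y_{1-p}`. -/
def generalTrimean (α p : ℝ) {n : ℕ} (x : Fin n → ℝ) : ℝ :=
  α / 2 * sampleQuantile x p + (1 - α) * sampleQuantile x (1 / 2)
    + α / 2 * sampleQuantile x (1 - p)

/-- Tukey's trimean: `α = 1/2`, `p = 1/4`. -/
def tukeyTrimean {n : ℕ} (x : Fin n → ℝ) : ℝ := generalTrimean (1 / 2) (1 / 4) x

/-- The Gastwirth estimator: `α = 0.6`, `p = 1/3`. -/
def gastwirth {n : ℕ} (x : Fin n → ℝ) : ℝ := generalTrimean 0.6 (1 / 3) x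

/-- The slope of the least squares regression line through the points `(j, y j)`, `j = 1, …, J`. -/
def regressionSlope (J : ℕ) (y : ℕ → ℝ) : ℝ :=
  let xbar : ℝ := (∑ j ∈ Finset.Icc 1 J, (j : ℝ)) / J
  let ybar : ℝ := (∑ j ∈ Finset.Icc 1 J, y j) / J
  (∑ j ∈ Finset.Icc 1 J, ((j : ℝ) - xbar) * (y j - ybar)) /
    ∑ j ∈ Finset.Icc 1 J, ((j : ℝ) - xbar) ^ 2

/-- The estimator `-β̄/2 - 1/2` of the Hurst exponent, where `β̄` is the average over the groups
`i = 1, …, M` of the regression slopes on the pairs `(j, log₂ (m j i))`, `j = 1, …, J`. -/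
def hurstEstimator (J M : ℕ) (m : ℕ → ℕ → ℝ) : ℝ :=
  -((∑ i ∈ Finset.Icc 1 M, regressionSlope J fun j => Real.logb 2 (m j i)) / M) / 2 - 1 / 2

end

/-! Everything reduces to i.i.d. standard exponential samples. Stationary increments and
self-similarity of $B$, with $\int\psi=0$, turn a level-$j$ coefficient into $2^{-j/2-jH}$ times a
level-0 coefficient of another fractional Brownian motion. Such an integral is Gaussian because it
lies in the closed linear span of $B$ in $L^2$ (`hasLaw_integral_path_mul`), so each coefficient is
$\mathcal N(0,\lambda_j)$ (`IsFractionalBrownianMotion.hasLaw_ndwtCoeff`). Half the sum of squares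
of two independent such variables is exponential with mean $\lambda_j$ (`hasLaw_half_sq_add_sq`),
and the trimean is scale equivariant.

For normality, Bahadur's representation (`tendstoInMeasure_orderStat_sub`) replaces each sample
quantile, up to $o_P(n^{-1/2})$, by the empirical distribution function at the true quantile divided
by the density there. The trimean thus becomes an average of i.i.d. influence terms, to which the
central limit theorem applies. With $n=N/(2M)$ the variance $v/n$ is $2vM/N$, where $v=5/6$ or
$v=0.835$.

For consistency, $\log_2(c\lambda_j)$ is affine in $j$ with slope $-(2H+1)$, whatever the factor
$c$. Since $M$ may grow and nothing is known about dependence between groups or levels, convergence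
in probability within each group is not enough. The logarithms are shown to converge in $L^1$
(`tendsto_lintegral_abs_log_generalTrimean`): the log of the trimean is dominated by an average of
$|\log X_i|$, which is bounded in $L^2$. The mean error is the same for all groups, so averaging
over them costs nothing, and Markov's inequality concludes. -/

/-! ### Order statistics: counting, measurability, scaling, logarithmic bounds. -/

section OrderStatistics

lemma orderStat_of_mem {n : ℕ} (x : Fin n → ℝ) {k : ℕ} (h1 : 1 ≤ k) (hn : k ≤ n) :
    orderStat x k = x (Tuple.sort x ⟨k - 1, by omega⟩) := by
  rw [orderStat, dif_pos ⟨h1, hn⟩]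

/-- This passage from ranks to counts is what links order statistics to the empirical distribution
function; measurability and scaling follow from it as well. -/
lemma orderStat_le_iff {n : ℕ} (x : Fin n → ℝ) {k : ℕ} (h1 : 1 ≤ k) (hn : k ≤ n) (t : ℝ) :
    orderStat x k ≤ t ↔ k ≤ (Finset.univ.filter fun i => x i ≤ t).card := by
  have hmono : Monotone (x ∘ Tuple.sort x) := Tuple.monotone_sort x
  have hcard : (Finset.univ.filter fun i => x i ≤ t).card
      = (Finset.univ.filter fun i => x (Tuple.sort x i) ≤ t).card := by
    refine (Finset.card_bij (fun i _ => Tuple.sort x i) ?_ ?_ ?_).symm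
    · intro i hi; simpa using hi
    · intro a _ b _ h; exact (Tuple.sort x).injective h
    · intro b hb
      exact ⟨(Tuple.sort x).symm b, by simpa using hb, by simp⟩
  rw [orderStat_of_mem x h1 hn, hcard]
  constructor
  · intro h
    have hsub : (Finset.Iic (⟨k - 1, by omega⟩ : Fin n)) ⊆
        Finset.univ.filter fun i => x (Tuple.sort x i) ≤ t := by
      intro i hi
      simp only [Finset.mem_filter, Finset.mem_univ, true_and]
      exact (hmono (Finset.mem_Iic.1 hi)).trans h
    have := Finset.card_le_card hsub
    rw [Fin.card_Iic] at this
    simp only at this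
    omega
  · intro h
    by_contra! hlt
    have hsub : (Finset.univ.filter fun i => x (Tuple.sort x i) ≤ t) ⊆
        Finset.Iio (⟨k - 1, by omega⟩ : Fin n) := by
      intro i hi
      simp only [Finset.mem_filter, Finset.mem_univ, true_and] at hi
      rw [Finset.mem_Iio]
      by_contra! hge
      have := hmono hge
      simp only [Function.comp] at this
      linarith
    have := Finset.card_le_card hsub
    rw [Fin.card_Iio] at this
    simp only at this
    omega

lemma measurable_orderStat (n k : ℕ) : Measurable fun x : Fin n → ℝ => orderStat x k := by
  by_cases h : 1 ≤ k ∧ k ≤ n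
  · refine measurable_of_Iic fun t => ?_
    have : (fun x : Fin n → ℝ => orderStat x k) ⁻¹' Set.Iic t
        = (fun x : Fin n → ℝ => ∑ i, if x i ≤ t then 1 else 0) ⁻¹' Set.Ici k := by
      ext x
      simp [orderStat_le_iff x h.1 h.2]
    have hm : Measurable fun x : Fin n → ℝ => ∑ i, if x i ≤ t then (1 : ℕ) else 0 :=
      Finset.measurable_sum _ fun i _ =>
        Measurable.ite (measurableSet_le (measurable_pi_apply i) measurable_const)
          measurable_const measurable_const
    rw [this]
    exact hm measurableSet_Ici
  · simp only [orderStat, dif_neg h]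
    exact measurable_const

lemma orderStat_const_mul {n : ℕ} (x : Fin n → ℝ) (k : ℕ) {a : ℝ} (ha : 0 < a) :
    orderStat (fun i => a * x i) k = a * orderStat x k := by
  by_cases h : 1 ≤ k ∧ k ≤ n
  · refine eq_of_forall_ge_iff fun t => ?_
    rw [orderStat_le_iff _ h.1 h.2, ← le_div_iff₀' ha, orderStat_le_iff _ h.1 h.2]
    simp only [le_div_iff₀' ha]
  · simp [orderStat, dif_neg h]

lemma orderStat_pos {n : ℕ} {x : Fin n → ℝ} (hx : ∀ i, 0 < x i) {k : ℕ} (h1 : 1 ≤ k)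
    (hn : k ≤ n) : 0 < orderStat x k := by
  rw [orderStat_of_mem x h1 hn]
  exact hx _

/-- At least `k` and at least `n - k + 1` of the observations lie on either side of the `k`-th order
statistic, which bounds its logarithm by the sum of the logarithms of the observations. -/
lemma min_mul_abs_log_orderStat_le {n : ℕ} {x : Fin n → ℝ} (hx : ∀ i, 0 < x i) {k : ℕ}
    (h1 : 1 ≤ k) (hn : k ≤ n) :
    (min k (n - k) : ℕ) * |Real.log (orderStat x k)| ≤ ∑ i, |Real.log (x i)| := by
  set y := orderStat x k with hy
  have hypos : 0 < y := orderStat_pos hx h1 hn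
  have key (s : Finset (Fin n)) (hs : min k (n - k) ≤ s.card)
      (h : ∀ i ∈ s, |Real.log y| ≤ |Real.log (x i)|) :
      (min k (n - k) : ℕ) * |Real.log y| ≤ ∑ i, |Real.log (x i)| := by
    calc ((min k (n - k) : ℕ) : ℝ) * |Real.log y| ≤ s.card * |Real.log y| := by gcongr
      _ = ∑ i ∈ s, |Real.log y| := by simp
      _ ≤ ∑ i ∈ s, |Real.log (x i)| := Finset.sum_le_sum h
      _ ≤ _ := Finset.sum_le_sum_of_subset_of_nonneg (Finset.subset_univ _)
        fun _ _ _ => abs_nonneg _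
  have hle := (orderStat_le_iff x h1 hn y).1 le_rfl
  -- For $y\ge1$ the observations above $y$ have the larger $|\log|$; for $y\le1$ those below do.
  rcases le_total 1 y with h | h
  · refine key (Finset.univ.filter fun i => y ≤ x i) ?_ ?_
    · have hlt : (Finset.univ.filter fun i => x i < y).card ≤ k := by
        by_contra! hk
        have hne : (Finset.univ.filter fun i => x i < y).Nonempty :=
          Finset.card_pos.1 (by omega)
        set t := (Finset.univ.filter fun i => x i < y).sup' hne x
        have ht : t < y := by
          rw [Finset.sup'_lt_iff]
          intro i hi
          simpa using hi
        refine absurd ((orderStat_le_iff x h1 hn t).2 (hk.le.trans (Finset.card_le_card ?_)))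
          (not_le.2 ht)
        intro i hi
        simpa using Finset.le_sup' x hi
      have := Finset.card_filter_add_card_filter_not (s := (Finset.univ : Finset (Fin n)))
        (fun i => x i < y)
      simp only [not_lt, Finset.card_univ, Fintype.card_fin] at this
      omega
    · intro i hi
      have hi' : y ≤ x i := by simpa using hi
      rw [abs_of_nonneg (Real.log_nonneg h), abs_of_nonneg (Real.log_nonneg (h.trans hi'))]
      exact Real.log_le_log hypos hi'
  · refine key (Finset.univ.filter fun i => x i ≤ y) (by omega) ?_
    intro i hi
    have hi' : x i ≤ y := by simpa using hi
    rw [abs_of_nonpos (Real.log_nonpos hypos.le h),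
      abs_of_nonpos (Real.log_nonpos (hx i).le (hi'.trans h))]
    exact neg_le_neg (Real.log_le_log (hx i) hi')

end OrderStatistics

/-! ### The general trimean and its logarithm. -/

section GeneralTrimean

lemma measurable_generalTrimean (α p : ℝ) (n : ℕ) :
    Measurable fun x : Fin n → ℝ => generalTrimean α p x := by
  have h (q : ℝ) : Measurable fun x : Fin n → ℝ => sampleQuantile x q :=
    measurable_orderStat n _
  exact (((h p).const_mul _).add ((h _).const_mul _)).add ((h _).const_mul _)

lemma generalTrimean_const_mul (α p : ℝ) {n : ℕ} (x : Fin n → ℝ) {a : ℝ} (ha : 0 < a) :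
    generalTrimean α p (fun i => a * x i) = a * generalTrimean α p x := by
  simp only [generalTrimean, sampleQuantile, orderStat_const_mul _ _ ha]
  ring

lemma one_le_floor_mul {n : ℕ} {p q : ℝ} (hq : q ≤ p) (hn : 1 ≤ n * q) :
    1 ≤ ⌊(n : ℝ) * p⌋₊ :=
  Nat.le_floor (by push_cast; nlinarith [(n.cast_nonneg : (0 : ℝ) ≤ n)])

lemma floor_mul_le {n : ℕ} {p : ℝ} (hp : p ≤ 1) : ⌊(n : ℝ) * p⌋₊ ≤ n :=
  Nat.floor_le_of_le (by nlinarith [(n.cast_nonneg : (0 : ℝ) ≤ n)])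

/-- The rank $k=\lfloor np\rfloor$ satisfies $k>nq-1\ge nq/2$ and $n-k\ge nq$, so a fixed fraction
of the sample lies on each side of the quantile. The bound yields $L^2$ control uniform in $n$. -/
lemma abs_log_sampleQuantile_le {n : ℕ} {x : Fin n → ℝ} (hx : ∀ i, 0 < x i) {p q : ℝ}
    (hq : 0 < q) (hqp : q ≤ p) (hpq : p ≤ 1 - q) (hn : 1 ≤ n * (q / 2)) :
    |Real.log (sampleQuantile x p)| ≤ (2 / q) * ((∑ i, |Real.log (x i)|) / n) := by
  have hn0 : (0 : ℝ) < n := by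
    by_contra! h
    nlinarith
  have h1 : 1 ≤ ⌊(n : ℝ) * p⌋₊ := one_le_floor_mul (q := q / 2) (by linarith) hn
  have h2 : ⌊(n : ℝ) * p⌋₊ ≤ n := floor_mul_le (by linarith)
  have := min_mul_abs_log_orderStat_le hx h1 h2
  have hmin : n * (q / 2) ≤ (min ⌊(n : ℝ) * p⌋₊ (n - ⌊(n : ℝ) * p⌋₊) : ℕ) := by
    rw [Nat.cast_min, Nat.cast_sub h2]
    have := Nat.sub_one_lt_floor ((n : ℝ) * p)
    have := Nat.floor_le (show 0 ≤ (n : ℝ) * p by nlinarith)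
    refine le_min ?_ ?_ <;> nlinarith
  have h3 : n * (q / 2) * |Real.log (sampleQuantile x p)| ≤ ∑ i, |Real.log (x i)| :=
    (mul_le_mul_of_nonneg_right hmin (abs_nonneg _)).trans this
  rw [← mul_div_assoc, le_div_iff₀ hn0, div_mul_eq_mul_div, le_div_iff₀ hq]
  linarith

/-- $|\log u|\le L$ means $u\in[e^{-L},e^{L}]$, a convex condition. -/
lemma abs_log_weighted_le {a b c u v w L : ℝ} (ha : 0 ≤ a) (hb : 0 ≤ b) (hc : 0 ≤ c)
    (hsum : a + b + c = 1) (hu : 0 < u) (hv : 0 < v) (hw : 0 < w) (hLu : |Real.log u| ≤ L)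
    (hLv : |Real.log v| ≤ L) (hLw : |Real.log w| ≤ L) :
    0 < a * u + b * v + c * w ∧ |Real.log (a * u + b * v + c * w)| ≤ L := by
  rw [abs_le, Real.le_log_iff_exp_le (by assumption), Real.log_le_iff_le_exp (by assumption)]
    at hLu hLv hLw
  have h1 : Real.exp (-L) ≤ a * u + b * v + c * w := by
    calc Real.exp (-L) = a * Real.exp (-L) + b * Real.exp (-L) + c * Real.exp (-L) := by
          rw [← add_mul, ← add_mul, hsum, one_mul]
      _ ≤ _ := by gcongr <;> tauto
  have h2 : a * u + b * v + c * w ≤ Real.exp L := by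
    calc a * u + b * v + c * w ≤ a * Real.exp L + b * Real.exp L + c * Real.exp L := by
          gcongr <;> tauto
      _ = _ := by rw [← add_mul, ← add_mul, hsum, one_mul]
  have h3 := (Real.exp_pos _).trans_le h1
  refine ⟨h3, ?_⟩
  rw [abs_le, Real.le_log_iff_exp_le h3, Real.log_le_iff_le_exp h3]
  exact ⟨h1, h2⟩

lemma abs_log_generalTrimean_le {α p : ℝ} (hα : α ∈ Set.Icc (0 : ℝ) 1)
    (hp : p ∈ Set.Ioc (0 : ℝ) (1 / 2)) {n : ℕ} (hn : 1 ≤ n * (p / 2)) {x : Fin n → ℝ}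
    (hx : ∀ i, 0 < x i) :
    0 < generalTrimean α p x ∧
      |Real.log (generalTrimean α p x)| ≤ (2 / p) * ((∑ i, |Real.log (x i)|) / n) := by
  obtain ⟨hα0, hα1⟩ := hα
  obtain ⟨hp0, hp1⟩ := hp
  have hpos (q : ℝ) (h1 : p ≤ q) (h2 : q ≤ 1 - p) : 0 < sampleQuantile x q :=
    orderStat_pos hx (one_le_floor_mul (q := p / 2) (by linarith) hn) (floor_mul_le (by linarith))
  have hlog (q : ℝ) (h1 : p ≤ q) (h2 : q ≤ 1 - p) := abs_log_sampleQuantile_le hx hp0 h1 h2 hn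
  exact abs_log_weighted_le (by linarith) (by linarith) (by linarith) (by ring)
    (hpos _ le_rfl (by linarith)) (hpos _ hp1 (by linarith)) (hpos _ (by linarith) le_rfl)
    (hlog _ le_rfl (by linarith)) (hlog _ hp1 (by linarith)) (hlog _ (by linarith) le_rfl)

end GeneralTrimean

/-! ### The exponential law: logarithmic moments, origin from Gaussian pairs, quantiles. -/

section ExponentialLaw

lemma expMeasure_one_eq :
    expMeasure 1 = (volume.restrict (Set.Ioi 0)).withDensity
      fun x => ENNReal.ofReal (Real.exp (-x)) := by
  rw [expMeasure, gammaMeasure, restrict_Ioi_eq_restrict_Ici,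
    ← withDensity_indicator measurableSet_Ici]
  congr 1
  ext x
  change exponentialPDF 1 x = _
  rw [exponentialPDF_eq]
  by_cases hx : 0 ≤ x <;> simp [Set.indicator, hx]

lemma ae_pos_expMeasure : ∀ᵐ x ∂(expMeasure 1), 0 < x := by
  rw [expMeasure_one_eq]
  exact (withDensity_absolutelyContinuous _ _).ae_le (ae_restrict_mem measurableSet_Ioi)

/-- Bounding $\log x$ by $4x^{1/4}$ and $-\log x$ by $4x^{-1/4}$ dominates $\log^2x\,e^{-x}$ by the
integrands of $\Gamma(3/2)$ and $\Gamma(1/2)$. -/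
lemma memLp_log_expMeasure : MemLp Real.log 2 (expMeasure 1) := by
  rw [memLp_two_iff_integrable_sq Real.measurable_log.aestronglyMeasurable, expMeasure_one_eq,
    integrable_withDensity_iff_integrable_smul' (by fun_prop) (by simp)]
  have hG (s : ℝ) (hs : 0 < s) := Real.GammaIntegral_convergent hs
  refine Integrable.mono' (g := fun x => 32 * (Real.exp (-x) * x ^ ((3 / 2 : ℝ) - 1)
    + Real.exp (-x) * x ^ ((1 / 2 : ℝ) - 1)))
    (((hG _ (by norm_num)).add (hG _ (by norm_num))).const_mul 32) (by fun_prop) ?_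
  filter_upwards [ae_restrict_mem measurableSet_Ioi] with x hx
  have hx : 0 < x := hx
  have h1 : Real.log x ≤ 4 * x ^ (1 / 4 : ℝ) := by
    have := Real.log_le_rpow_div hx.le (ε := 1 / 4) (by norm_num)
    linarith
  have h2 : -Real.log x ≤ 4 * x ^ (-(1 / 4) : ℝ) := by
    have := Real.log_le_rpow_div (inv_pos.2 hx).le (ε := 1 / 4) (by norm_num)
    rw [Real.log_inv, Real.inv_rpow hx.le, ← Real.rpow_neg hx.le] at this
    linarith
  have h3 : x ^ ((3 / 2 : ℝ) - 1) = (x ^ (1 / 4 : ℝ)) ^ 2 := by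
    rw [← Real.rpow_natCast, ← Real.rpow_mul hx.le]; norm_num
  have h4 : x ^ ((1 / 2 : ℝ) - 1) = (x ^ (-(1 / 4) : ℝ)) ^ 2 := by
    rw [← Real.rpow_natCast, ← Real.rpow_mul hx.le]; norm_num
  have h5 : Real.log x ^ 2 ≤ 32 * ((x ^ (1 / 4 : ℝ)) ^ 2 + (x ^ (-(1 / 4) : ℝ)) ^ 2) := by
    have a := Real.rpow_pos_of_pos hx (1 / 4)
    have b := Real.rpow_pos_of_pos hx (-(1 / 4))
    rcases le_total 0 (Real.log x) with h | h <;> nlinarith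
  rw [h3, h4, ENNReal.toReal_ofReal (Real.exp_pos _).le, smul_eq_mul, Real.norm_of_nonneg
    (mul_nonneg (Real.exp_pos _).le (sq_nonneg _))]
  nlinarith [Real.exp_pos (-x)]

/-- In polar coordinates the integrand does not depend on the angle, and $u=r^2/(2v)$ turns the
radial integral into an exponential one. -/
lemma gaussianReal_prod_map_half_sq_add_sq {v : NNReal} (hv : v ≠ 0) :
    ((gaussianReal 0 v).prod (gaussianReal 0 v)).map
      (fun p : ℝ × ℝ => (p.1 ^ 2 + p.2 ^ 2) / 2 / v) = expMeasure 1 := by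
  have hv' : (0 : ℝ) < v := by positivity
  ext s hs
  rw [Measure.map_apply (by fun_prop) hs, gaussianReal_of_var_ne_zero 0 hv,
    prod_withDensity (by fun_prop) (by fun_prop),
    withDensity_apply _ (hs.preimage (by fun_prop)),
    ← lintegral_indicator (hs.preimage (by fun_prop)), ← Measure.volume_eq_prod,
    ← lintegral_comp_polarCoord_symm]
  -- The factor $1/(2\pi v)$ of the Gaussian density is split: $1/(2\pi)$ cancels the angular
  -- integral, and $r/v$ is the derivative of $r\mapsto r^2/(2v)$.
  set h : ℝ → ENNReal := fun r => ENNReal.ofReal (r / v) *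
    s.indicator (fun u => ENNReal.ofReal (Real.exp (-u))) (r ^ 2 / 2 / v) with hh
  have hpt : ∀ p ∈ polarCoord.target, ENNReal.ofReal p.1 •
      ((fun p : ℝ × ℝ => (p.1 ^ 2 + p.2 ^ 2) / 2 / (v : ℝ)) ⁻¹' s).indicator
        (fun a => gaussianPDF 0 v a.1 * gaussianPDF 0 v a.2) (polarCoord.symm p)
      = ENNReal.ofReal (1 / (2 * Real.pi)) * h p.1 := by
    intro p hp
    have hp1 : 0 < p.1 := by
      rw [polarCoord_target] at hp
      exact hp.1
    have hsq : (p.1 * Real.cos p.2) ^ 2 + (p.1 * Real.sin p.2) ^ 2 = p.1 ^ 2 := by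
      linear_combination p.1 ^ 2 * Real.sin_sq_add_cos_sq p.2
    have hmem : polarCoord.symm p ∈ (fun p : ℝ × ℝ => (p.1 ^ 2 + p.2 ^ 2) / 2 / (v : ℝ)) ⁻¹' s
        ↔ p.1 ^ 2 / 2 / v ∈ s := by
      simp only [polarCoord_symm_apply, Set.mem_preimage, hsq]
    simp only [hh]
    by_cases hps : p.1 ^ 2 / 2 / v ∈ s
    · rw [Set.indicator_of_mem (hmem.2 hps), Set.indicator_of_mem hps, smul_eq_mul,
        polarCoord_symm_apply, gaussianPDF, gaussianPDF,
        ← ENNReal.ofReal_mul (gaussianPDFReal_nonneg _ _ _),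
        ← ENNReal.ofReal_mul hp1.le, ← ENNReal.ofReal_mul (by positivity),
        ← ENNReal.ofReal_mul (by positivity)]
      congr 1
      simp only [gaussianPDFReal, sub_zero]
      have e : Real.exp (-(p.1 * Real.cos p.2) ^ 2 / (2 * v)) *
          Real.exp (-(p.1 * Real.sin p.2) ^ 2 / (2 * v)) = Real.exp (-(p.1 ^ 2 / 2 / v)) := by
        rw [← Real.exp_add, ← hsq]
        congr 1
        field_simp
        ring
      have hs : √(2 * Real.pi * v) * √(2 * Real.pi * v) = 2 * Real.pi * v :=
        Real.mul_self_sqrt (by positivity)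
      calc _ = p.1 * ((√(2 * Real.pi * v) * √(2 * Real.pi * v))⁻¹ *
          (Real.exp (-(p.1 * Real.cos p.2) ^ 2 / (2 * v)) *
          Real.exp (-(p.1 * Real.sin p.2) ^ 2 / (2 * v)))) := by
            rw [mul_inv]; ring
        _ = _ := by
            rw [e, hs]; field_simp
    · rw [Set.indicator_of_notMem (mt hmem.1 hps), Set.indicator_of_notMem hps]
      simp
  rw [setLIntegral_congr_fun polarCoord.open_target.measurableSet hpt, polarCoord_target,
    Measure.volume_eq_prod]
  have hhm : Measurable h := by
    refine Measurable.mul (by fun_prop) ?_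
    exact Measurable.comp (Measurable.indicator (by fun_prop) hs) (by fun_prop)
  rw [lintegral_const_mul _ (by fun_prop), ← Measure.prod_restrict,
    lintegral_prod _ (by fun_prop)]
  simp only [lintegral_const, Measure.restrict_apply MeasurableSet.univ, Set.univ_inter,
    Real.volume_Ioo]
  rw [lintegral_mul_const _ hhm, mul_comm, mul_assoc, ← ENNReal.ofReal_mul (by
    linarith [Real.pi_pos])]
  have : (Real.pi - -Real.pi) * (1 / (2 * Real.pi)) = 1 := by
    field_simp; ring
  rw [this, ENNReal.ofReal_one, mul_one, expMeasure_one_eq, withDensity_apply _ hs,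
    ← lintegral_indicator hs]
  have himg : (fun r : ℝ => r ^ 2 / 2 / v) '' Set.Ioi 0 = Set.Ioi 0 := by
    ext u
    simp only [Set.mem_image, Set.mem_Ioi]
    constructor
    · rintro ⟨r, hr, rfl⟩
      positivity
    · intro hu
      refine ⟨√(2 * v * u), by positivity, ?_⟩
      rw [Real.sq_sqrt (by positivity)]
      field_simp
  conv_rhs => rw [← himg]
  rw [lintegral_image_eq_lintegral_abs_deriv_mul (f' := fun r => r / v) measurableSet_Ioi]
  · refine setLIntegral_congr_fun measurableSet_Ioi fun r hr => ?_
    have hr : 0 < r := hr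
    simp only [hh, abs_of_pos (div_pos hr hv')]
  · intro r _
    exact (((hasDerivAt_pow 2 r).div_const 2).div_const (v : ℝ)).hasDerivWithinAt.congr_deriv
      (by simp)
  · intro a ha b hb hab
    have ha : 0 < a := ha
    have hb : 0 < b := hb
    have hab : a ^ 2 / 2 / v = b ^ 2 / 2 / (v : ℝ) := hab
    rw [div_left_inj' hv'.ne', div_left_inj' (two_ne_zero' ℝ)] at hab
    exact (pow_left_inj₀ ha.le hb.le two_ne_zero).1 hab

/-- Half the sum of the squares of two independent centred Gaussian variables of variance `v` is
exponentially distributed with mean `v`. -/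
lemma hasLaw_half_sq_add_sq {Ω : Type*} [MeasurableSpace Ω] {P : Measure Ω}
    [IsProbabilityMeasure P] {X Y : Ω → ℝ} {v : NNReal} (hv : v ≠ 0)
    (hX : HasLaw X (gaussianReal 0 v) P) (hY : HasLaw Y (gaussianReal 0 v) P)
    (hXY : IndepFun X Y P) :
    HasLaw (fun ω => (X ω ^ 2 + Y ω ^ 2) / 2 / v) (expMeasure 1) P := by
  have h1 := (indepFun_iff_hasLaw_prodMk_prod hX hY).1 hXY
  have h2 : HasLaw (fun p : ℝ × ℝ => (p.1 ^ 2 + p.2 ^ 2) / 2 / v) (expMeasure 1)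
      ((gaussianReal 0 v).prod (gaussianReal 0 v)) :=
    ⟨by fun_prop, gaussianReal_prod_map_half_sq_add_sq hv⟩
  exact h2.fun_comp h1

lemma hasDerivAt_cdf_expMeasure {x : ℝ} (hx : 0 < x) :
    HasDerivAt (cdf (expMeasure 1)) (Real.exp (-x)) x := by
  have h : HasDerivAt (fun x : ℝ => 1 - Real.exp (-x)) (Real.exp (-x)) x := by
    have := ((hasDerivAt_neg x).exp).const_sub 1
    simpa using this
  refine h.congr_of_eventuallyEq ?_
  filter_upwards [lt_mem_nhds hx] with y hy
  rw [cdf_expMeasure_eq one_pos, if_pos hy.le, one_mul]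

lemma cdf_expMeasure_neg_log {p : ℝ} (hp : p ∈ Set.Ioo (0 : ℝ) 1) :
    cdf (expMeasure 1) (-Real.log (1 - p)) = p := by
  have h1 : 0 < 1 - p := by linarith [hp.2]
  have h2 : Real.log (1 - p) < 0 := Real.log_neg h1 (by linarith [hp.1])
  rw [cdf_expMeasure_eq one_pos, if_pos (by linarith), one_mul, neg_neg, Real.exp_log h1]
  ring

end ExponentialLaw

/-! ### Tools for convergence in probability: Ghosh's lemma, Chebyshev's inequality. -/

section ConvergenceInProbability

variable {Ω : Type*} [MeasurableSpace Ω] {P : Measure Ω} [IsProbabilityMeasure P]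

lemma tendsto_zero_of_forall_eventually_le {u : ℕ → ℝ} (h0 : ∀ n, 0 ≤ u n)
    (h : ∀ δ : ℝ, 0 < δ → ∀ᶠ n in atTop, u n ≤ δ) : Tendsto u atTop (𝓝 0) := by
  rw [Metric.tendsto_nhds]
  intro ε hε
  filter_upwards [h (ε / 2) (by positivity)] with n hn
  rw [Real.dist_0_eq_abs, abs_of_nonneg (h0 n)]
  linarith

/-- **Ghosh's lemma**: two sequences of random variables, one of which is tight, are asymptotically
equal if they are asymptotically on the same side of every level. -/
lemma tendstoInMeasure_sub_of_same_side {V W : ℕ → Ω → ℝ}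
    (tight : ∀ δ : ℝ, 0 < δ → ∃ K : ℝ, ∀ᶠ n in atTop, P.real {ω | K ≤ |W n ω|} ≤ δ)
    (hle : ∀ y ε : ℝ, 0 < ε →
      Tendsto (fun n => P.real {ω | V n ω ≤ y ∧ y + ε ≤ W n ω}) atTop (𝓝 0))
    (hge : ∀ y ε : ℝ, 0 < ε →
      Tendsto (fun n => P.real {ω | y < V n ω ∧ W n ω ≤ y - ε}) atTop (𝓝 0)) :
    TendstoInMeasure P (fun n ω => V n ω - W n ω) atTop fun _ => 0 := by
  rw [tendstoInMeasure_iff_measureReal_norm]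
  intro ε hε
  refine tendsto_zero_of_forall_eventually_le (fun _ => measureReal_nonneg) fun δ hδ => ?_
  obtain ⟨K, hK⟩ := tight (δ / 2) (by positivity)
  -- On a grid of mesh $\varepsilon/3$, let $W$ lie in $[\eta m,\eta(m+1))$. If $|V-W|\ge3\eta$,
  -- then $V$ and $W$ are separated by $\eta(m-1)$ or by $\eta(m+2)$ with margin $\eta$. Tightness
  -- leaves only finitely many $m$.
  set η := ε / 3 with hη
  have hη0 : 0 < η := by positivity
  set I : Finset ℤ := Finset.Icc ⌊-K / η⌋ ⌊K / η⌋ with hI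
  set A : ℤ → ℕ → Set Ω := fun m n =>
    {ω | V n ω ≤ η * (m - 1) ∧ η * (m - 1) + η ≤ W n ω} with hA
  set B : ℤ → ℕ → Set Ω := fun m n =>
    {ω | η * (m + 2) < V n ω ∧ W n ω ≤ η * (m + 2) - η} with hB
  have hsum : Tendsto (fun n => ∑ m ∈ I, (P.real (A m n) + P.real (B m n))) atTop (𝓝 0) := by
    have : Tendsto (fun n => ∑ m ∈ I, (P.real (A m n) + P.real (B m n))) atTop
        (𝓝 (∑ m ∈ I, ((0 : ℝ) + 0))) :=
      tendsto_finsetSum _ fun m _ => (hle _ _ hη0).add (hge _ _ hη0)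
    simpa using this
  filter_upwards [hK, hsum.eventually_le_const (u := δ / 2) (by positivity)] with n h1 h2
  have hsub : {ω | ε ≤ ‖V n ω - W n ω - 0‖} ⊆
      {ω | K ≤ |W n ω|} ∪ ⋃ m ∈ I, (A m n ∪ B m n) := by
    intro ω hω
    by_cases hKω : K ≤ |W n ω|
    · exact Or.inl hKω
    right
    simp only [Set.mem_ofPred_eq, sub_zero, Real.norm_eq_abs] at hω
    rw [not_le, abs_lt] at hKω
    have hm1 := Int.floor_le (W n ω / η)
    have hm2 := Int.lt_floor_add_one (W n ω / η)
    rw [le_div_iff₀ hη0] at hm1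
    rw [div_lt_iff₀ hη0] at hm2
    simp only [Set.mem_iUnion]
    refine ⟨⌊W n ω / η⌋, ?_, ?_⟩
    · rw [hI, Finset.mem_Icc]
      exact ⟨Int.floor_le_floor (div_le_div_of_nonneg_right hKω.1.le hη0.le),
        Int.floor_le_floor (div_le_div_of_nonneg_right hKω.2.le hη0.le)⟩
    · have hε3 : ε = 3 * η := by rw [hη]; ring
      rcases le_abs.1 hω with h | h
      · right
        simp only [hB, Set.mem_ofPred_eq]
        constructor <;> nlinarith
      · left
        simp only [hA, Set.mem_ofPred_eq]
        constructor <;> nlinarith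
  calc P.real {ω | ε ≤ ‖V n ω - W n ω - 0‖}
      ≤ P.real ({ω | K ≤ |W n ω|} ∪ ⋃ m ∈ I, (A m n ∪ B m n)) := measureReal_mono hsub
    _ ≤ P.real {ω | K ≤ |W n ω|} + P.real (⋃ m ∈ I, (A m n ∪ B m n)) := measureReal_union_le _ _
    _ ≤ P.real {ω | K ≤ |W n ω|} + ∑ m ∈ I, P.real (A m n ∪ B m n) := by
        gcongr; exact measureReal_biUnion_finset_le _ _
    _ ≤ P.real {ω | K ≤ |W n ω|} + ∑ m ∈ I, (P.real (A m n) + P.real (B m n)) := by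
        gcongr; exact measureReal_union_le _ _
    _ ≤ δ := by linarith

/-- A convex combination is at most the largest of the three absolute values, so the same
$\varepsilon$ serves all three terms. -/
lemma tendstoInMeasure_zero_weighted {U V W : ℕ → Ω → ℝ} {a b c : ℝ} (ha : 0 ≤ a) (hb : 0 ≤ b)
    (hc : 0 ≤ c) (hsum : a + b + c = 1) (hU : TendstoInMeasure P U atTop fun _ => 0)
    (hV : TendstoInMeasure P V atTop fun _ => 0) (hW : TendstoInMeasure P W atTop fun _ => 0) :
    TendstoInMeasure P (fun n ω => a * U n ω + b * V n ω + c * W n ω) atTop fun _ => 0 := by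
  rw [tendstoInMeasure_iff_measureReal_norm] at *
  intro ε hε
  have := ((hU ε hε).add (hV ε hε)).add (hW ε hε)
  simp only [add_zero, sub_zero, Real.norm_eq_abs] at this ⊢
  refine squeeze_zero (fun _ => measureReal_nonneg) (fun n => ?_) this
  refine (measureReal_mono (s₂ := {ω | ε ≤ |U n ω|} ∪ {ω | ε ≤ |V n ω|} ∪ {ω | ε ≤ |W n ω|})
    ?_).trans ((measureReal_union_le _ _).trans (by gcongr; exact measureReal_union_le _ _))
  intro ω hω
  by_contra! h
  simp only [Set.mem_union, Set.mem_ofPred_eq, not_or, not_le] at h hω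
  obtain ⟨⟨h1, h2⟩, h3⟩ := h
  have h4 : |a * U n ω + b * V n ω + c * W n ω| ≤ a * |U n ω| + b * |V n ω| + c * |W n ω| := by
    refine (abs_add_three _ _ _).trans_eq ?_
    rw [abs_mul, abs_mul, abs_mul, abs_of_nonneg ha, abs_of_nonneg hb, abs_of_nonneg hc]
  have hmax := max_lt (max_lt h1 h2) h3
  set M := max (max |U n ω| |V n ω|) |W n ω|
  have : a * |U n ω| + b * |V n ω| + c * |W n ω| ≤ a * M + b * M + c * M := by
    gcongr
    · exact (le_max_left _ _).trans (le_max_left _ _)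
    · exact (le_max_right _ _).trans (le_max_left _ _)
    · exact le_max_right _ _
  rw [← add_mul, ← add_mul, hsum, one_mul] at this
  linarith

/-- **Chebyshev's inequality** for normalized sums of independent identically distributed
variables. -/
lemma measureReal_le_abs_normalized_sum {ν : Measure ℝ} {X : ℕ → Ω → ℝ}
    (hlaw : ∀ i, HasLaw (X i) ν P) (hind : iIndepFun X P) {h : ℝ → ℝ} (hh : Measurable h)
    (hL : MemLp h 2 ν) (n : ℕ) {ε : ℝ} (hε : 0 < ε) :
    P.real {ω | ε ≤ |(√n)⁻¹ * ∑ i ∈ Finset.range n, (h (X i ω) - ∫ x, h x ∂ν)|}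
      ≤ (∫ x, h x ^ 2 ∂ν) / ε ^ 2 := by
  have hν : IsProbabilityMeasure ν := (hlaw 0).isProbabilityMeasure_iff.1 ‹_›
  have hLi (i : ℕ) : MemLp (fun ω => h (X i ω)) 2 P := by
    have := (hlaw i).map_eq ▸ hL
    exact this.comp_of_map (hlaw i).aemeasurable
  have hmean (i : ℕ) : ∫ ω, h (X i ω) ∂P = ∫ x, h x ∂ν :=
    (hlaw i).integral_comp (f := h) hh.aestronglyMeasurable
  have hvar (i : ℕ) : variance (fun ω => h (X i ω)) P ≤ ∫ x, h x ^ 2 ∂ν := by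
    refine (variance_le_expectation_sq (hLi i).1).trans_eq ?_
    exact (hlaw i).integral_comp (f := fun x => h x ^ 2) (hh.pow_const 2).aestronglyMeasurable
  set S : Ω → ℝ := fun ω => (√n)⁻¹ * (∑ i ∈ Finset.range n, fun ω => h (X i ω)) ω with hS
  have hSL : MemLp S 2 P := (memLp_finsetSum' _ fun i _ => hLi i).const_mul _
  have hSmean : ∫ ω, S ω ∂P = (√n)⁻¹ * ∑ i ∈ Finset.range n, ∫ x, h x ∂ν := by
    simp only [hS, Finset.sum_apply]
    rw [integral_const_mul, integral_finsetSum _ fun i _ => (hLi i).integrable one_le_two]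
    simp only [hmean]
  have hI : 0 ≤ ∫ x, h x ^ 2 ∂ν := integral_nonneg fun _ => sq_nonneg _
  have hSvar : variance S P ≤ ∫ x, h x ^ 2 ∂ν := by
    rw [hS, variance_const_mul, IndepFun.variance_sum (fun i _ => hLi i)]
    · calc (√n)⁻¹ ^ 2 * ∑ i ∈ Finset.range n, variance (fun ω => h (X i ω)) P
          ≤ (√n)⁻¹ ^ 2 * ∑ i ∈ Finset.range n, ∫ x, h x ^ 2 ∂ν := by
            gcongr; exact hvar _
        _ = ((n : ℝ)⁻¹ * n) * ∫ x, h x ^ 2 ∂ν := by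
            rw [inv_pow, Real.sq_sqrt n.cast_nonneg]; simp; ring
        _ ≤ 1 * ∫ x, h x ^ 2 ∂ν := by
            gcongr
            exact inv_mul_le_one_of_le₀ le_rfl n.cast_nonneg
        _ = _ := one_mul _
    · intro i _ j _ hij
      exact (hind.indepFun hij).comp hh hh
  have key := meas_ge_le_variance_div_sq hSL hε
  have heq : {ω | ε ≤ |(√n)⁻¹ * ∑ i ∈ Finset.range n, (h (X i ω) - ∫ x, h x ∂ν)|}
      = {ω | ε ≤ |S ω - P[S]|} := by
    ext ω
    rw [hSmean]
    simp only [hS, Finset.sum_apply, Finset.sum_sub_distrib, Set.mem_ofPred_eq, mul_sub]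
  rw [heq]
  calc P.real _ ≤ variance S P / ε ^ 2 :=
        ENNReal.toReal_le_of_le_ofReal (div_nonneg (variance_nonneg _ _) (sq_nonneg _)) key
    _ ≤ _ := by gcongr

end ConvergenceInProbability

/-! ### Empirical process and Bahadur's representation. -/

section OrderStatisticAsymptotics

/-- The empirical process `√n (F_n(x) - F(x))` of the sample `X_0, …, X_{n-1}` from `ν`. -/
noncomputable def empiricalDeviation {Ω : Type*} (ν : Measure ℝ) (X : ℕ → Ω → ℝ) (x : ℝ) (n : ℕ)
    (ω : Ω) : ℝ :=
  (√n)⁻¹ * ∑ i ∈ Finset.range n, ((Set.Iic x).indicator (fun _ => (1 : ℝ)) (X i ω) - cdf ν x)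

lemma orderStat_le_iff_empiricalDeviation {Ω : Type*} {ν : Measure ℝ} {X : ℕ → Ω → ℝ} {k n : ℕ}
    (h1 : 1 ≤ k) (hn : k ≤ n) (x : ℝ) (ω : Ω) :
    orderStat (fun i : Fin n => X i ω) k ≤ x ↔
      -empiricalDeviation ν X x n ω ≤ (n * cdf ν x - k) / √n := by
  have hn0 : (0 : ℝ) < n := by exact_mod_cast h1.trans hn
  have hs : 0 < √(n : ℝ) := Real.sqrt_pos.2 hn0
  have hcard : ((Finset.univ.filter fun i : Fin n => X i ω ≤ x).card : ℝ)
      = ∑ i ∈ Finset.range n, (Set.Iic x).indicator (fun _ => (1 : ℝ)) (X i ω) := by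
    rw [Finset.sum_range fun i => (Set.Iic x).indicator (fun _ => (1 : ℝ)) (X i ω)]
    simp [Set.indicator]
  rw [orderStat_le_iff _ h1 hn, ← Nat.cast_le (α := ℝ), hcard, le_div_iff₀ hs, empiricalDeviation,
    Finset.sum_sub_distrib]
  have : ∀ S : ℝ, -((√(n : ℝ))⁻¹ * S) * √(n : ℝ) = -S := fun S => by field_simp
  rw [this]
  simp only [Finset.sum_const, Finset.card_range, nsmul_eq_mul]
  constructor <;> intro h <;> linarith

variable {Ω : Type*} [MeasurableSpace Ω] {P : Measure Ω} [IsProbabilityMeasure P]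
  {ν : Measure ℝ} [IsProbabilityMeasure ν] {X : ℕ → Ω → ℝ}

lemma integral_indicator_Iic (x : ℝ) :
    ∫ u, (Set.Iic x).indicator (fun _ => (1 : ℝ)) u ∂ν = cdf ν x := by
  rw [integral_indicator measurableSet_Iic, setIntegral_const, cdf_eq_real]
  simp

lemma measurable_indicator_Iic (x : ℝ) :
    Measurable ((Set.Iic x).indicator fun _ => (1 : ℝ)) :=
  measurable_const.indicator measurableSet_Iic

lemma memLp_indicator_Iic (x : ℝ) : MemLp ((Set.Iic x).indicator fun _ => (1 : ℝ)) 2 ν :=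
  memLp_indicator_const 2 measurableSet_Iic 1 (Or.inr (measure_ne_top _ _))

lemma integrable_indicator_Iic (x : ℝ) :
    Integrable ((Set.Iic x).indicator fun _ => (1 : ℝ)) ν :=
  (memLp_indicator_Iic x).integrable one_le_two

/-- The half-lines are nested, so the squared difference is the indicator of the interval between
them. -/
lemma integral_sq_indicator_Iic_sub (x y : ℝ) :
    ∫ u, ((Set.Iic x).indicator (fun _ => (1 : ℝ)) u - (Set.Iic y).indicator (fun _ => 1) u) ^ 2 ∂ν
      = |cdf ν x - cdf ν y| := by
  wlog h : x ≤ y generalizing x y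
  · rw [abs_sub_comm, ← this y x (le_of_not_ge h)]
    congr 1 with u
    ring
  have : ∀ u, ((Set.Iic x).indicator (fun _ => (1 : ℝ)) u
      - (Set.Iic y).indicator (fun _ => 1) u) ^ 2
      = (Set.Iic y).indicator (fun _ => 1) u - (Set.Iic x).indicator (fun _ => 1) u := by
    intro u
    by_cases h1 : u ≤ x
    · simp [h1, h1.trans h]
    · by_cases h2 : u ≤ y <;> simp [h1, h2]
  simp only [this]
  rw [integral_sub (integrable_indicator_Iic y) (integrable_indicator_Iic x),
    integral_indicator_Iic, integral_indicator_Iic, abs_of_nonpos]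
  · ring
  · linarith [monotone_cdf ν h]

lemma measureReal_le_abs_empiricalDeviation (hlaw : ∀ i, HasLaw (X i) ν P) (hind : iIndepFun X P)
    (x : ℝ) (n : ℕ) {ε : ℝ} (hε : 0 < ε) :
    P.real {ω | ε ≤ |empiricalDeviation ν X x n ω|} ≤ 1 / ε ^ 2 := by
  have := measureReal_le_abs_normalized_sum hlaw hind (measurable_indicator_Iic x)
    (memLp_indicator_Iic x) n hε
  rw [integral_indicator_Iic] at this
  refine this.trans ?_
  gcongr
  have h : ∀ u, (Set.Iic x).indicator (fun _ => (1 : ℝ)) u ^ 2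
      = (Set.Iic x).indicator (fun _ => (1 : ℝ)) u := by
    intro u
    by_cases h1 : u ≤ x <;> simp [h1]
  simp only [h, integral_indicator_Iic]
  exact cdf_le_one ν x

/-- The bound is uniform in $n$ and vanishes as $x\to y$ wherever the distribution function is
continuous, so the empirical process may be frozen at $\xi$ when its argument is $\xi+y/\sqrt n$. -/
lemma measureReal_le_abs_empiricalDeviation_sub (hlaw : ∀ i, HasLaw (X i) ν P)
    (hind : iIndepFun X P) (x y : ℝ) (n : ℕ) {ε : ℝ} (hε : 0 < ε) :
    P.real {ω | ε ≤ |empiricalDeviation ν X x n ω - empiricalDeviation ν X y n ω|}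
      ≤ |cdf ν x - cdf ν y| / ε ^ 2 := by
  have := measureReal_le_abs_normalized_sum hlaw hind
    ((measurable_indicator_Iic x).sub (measurable_indicator_Iic y))
    ((memLp_indicator_Iic x).sub (memLp_indicator_Iic y)) n hε
  simp only [Pi.sub_apply] at this
  rw [integral_sub (integrable_indicator_Iic x) (integrable_indicator_Iic y),
    integral_indicator_Iic, integral_indicator_Iic, integral_sq_indicator_Iic_sub] at this
  convert this using 6 with ω
  simp only [empiricalDeviation]
  rw [← mul_sub, ← Finset.sum_sub_distrib]
  congr 2 with i
  ring

lemma tendsto_sqrt_natCast_atTop : Tendsto (fun n : ℕ => √(n : ℝ)) atTop atTop :=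
  Real.tendsto_sqrt_atTop.comp tendsto_natCast_atTop_atTop

/-- **Bahadur's representation** of an order statistic, with remainder in probability. -/
theorem tendstoInMeasure_orderStat_sub (hlaw : ∀ i, HasLaw (X i) ν P) (hind : iIndepFun X P)
    {ξ f : ℝ} (hf : 0 < f) (hderiv : HasDerivAt (cdf ν) f ξ) {k : ℕ → ℕ}
    (hk : ∀ᶠ n in atTop, 1 ≤ k n ∧ k n ≤ n)
    (hk' : Tendsto (fun n : ℕ => (n * cdf ν ξ - k n) / √n) atTop (𝓝 0)) :
    TendstoInMeasure P (fun (n : ℕ) ω => √n * (orderStat (fun i : Fin n => X i ω) (k n) - ξ)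
      - -empiricalDeviation ν X ξ n ω / f) atTop fun _ => 0 := by
  set x : ℝ → ℕ → ℝ := fun y n => ξ + (√(n : ℝ))⁻¹ * y with hx
  have hxlim (y : ℝ) : Tendsto (x y) atTop (𝓝 ξ) := by
    have := (tendsto_sqrt_natCast_atTop.inv_tendsto_atTop.mul_const y).const_add ξ
    simpa [hx] using this
  have hFx (y : ℝ) : Tendsto (fun n => cdf ν (x y n)) atTop (𝓝 (cdf ν ξ)) :=
    hderiv.continuousAt.tendsto.comp (hxlim y)
  have hdiff (y ε : ℝ) (hε : 0 < ε) : Tendsto (fun n => P.real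
      {ω | ε ≤ |empiricalDeviation ν X (x y n) n ω - empiricalDeviation ν X ξ n ω|})
      atTop (𝓝 0) := by
    refine squeeze_zero (fun _ => measureReal_nonneg)
      (fun n => measureReal_le_abs_empiricalDeviation_sub hlaw hind _ _ n hε) ?_
    have := (((hFx y).sub_const (cdf ν ξ)).abs).div_const (ε ^ 2)
    simpa using this
  have hlevel (y : ℝ) : Tendsto (fun n : ℕ => (n * cdf ν (x y n) - k n) / √n) atTop
      (𝓝 (f * y)) := by
    -- Differentiability at $\xi$ in the form $\sqrt n\,(F(\xi+y/\sqrt n)-F(\xi))\to fy$; `hk'`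
    -- absorbs the rounding of the rank.
    have h1 := hderiv.hasFDerivAt.lim y (c := fun n : ℕ => √(n : ℝ)) (l := atTop)
      (by simpa [abs_of_nonneg (Real.sqrt_nonneg _)] using tendsto_sqrt_natCast_atTop)
    have h2 := h1.add hk'
    simp only [smul_eq_mul, ContinuousLinearMap.toSpanSingleton_apply, add_zero] at h2
    rw [mul_comm]
    refine h2.congr' ?_
    filter_upwards [eventually_gt_atTop 0] with n hn
    have hn0 : (0 : ℝ) < n := by exact_mod_cast hn
    have hs : 0 < √(n : ℝ) := Real.sqrt_pos.2 hn0
    simp only [hx]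
    field_simp
    rw [Real.sq_sqrt hn0.le]
    ring
  have hV (y : ℝ) : ∀ᶠ n : ℕ in atTop, ∀ ω,
      √n * (orderStat (fun i : Fin n => X i ω) (k n) - ξ) ≤ y ↔
        -empiricalDeviation ν X (x y n) n ω ≤ (n * cdf ν (x y n) - k n) / √n := by
    filter_upwards [hk] with n hn ω
    have hn0 : (0 : ℝ) < n := by exact_mod_cast hn.1.trans hn.2
    have hs : 0 < √(n : ℝ) := Real.sqrt_pos.2 hn0
    rw [← orderStat_le_iff_empiricalDeviation hn.1 hn.2, ← le_div_iff₀' hs, sub_le_iff_le_add']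
    simp only [hx, div_eq_inv_mul]
  refine tendstoInMeasure_sub_of_same_side ?_ ?_ ?_
  · intro δ hδ
    -- The threshold $\sqrt{1/\delta}$ makes Chebyshev's bound exactly $\delta$.
    have hK : 0 < √(1 / δ) / f := by positivity
    refine ⟨√(1 / δ) / f, Eventually.of_forall fun n => ?_⟩
    have := measureReal_le_abs_empiricalDeviation hlaw hind ξ n (Real.sqrt_pos.2 (one_div_pos.2 hδ))
    rw [Real.sq_sqrt (by positivity), one_div_one_div] at this
    refine le_trans (le_of_eq ?_) this
    congr 1
    ext ω
    simp only [Set.mem_ofPred_eq, abs_div, abs_neg, abs_of_pos hf]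
    exact div_le_div_iff_of_pos_right hf
  · intro y ε hε
    -- With $G$ the empirical process, $V\le y$ gives $-G(x_n)<fy+f\varepsilon/2$ for large $n$,
    -- while $W\ge y+\varepsilon$ gives $-G(\xi)\ge fy+f\varepsilon$. The two values of $G$ then
    -- differ by at least $f\varepsilon/2$, an event of vanishing probability.
    have hfε : 0 < f * ε / 2 := by positivity
    refine squeeze_zero' (Eventually.of_forall fun _ => measureReal_nonneg) ?_
      (hdiff y _ hfε)
    filter_upwards [hV y, (hlevel y).eventually_lt_const (u := f * y + f * ε / 2) (by linarith)]
      with n hn hlt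
    refine measureReal_mono fun ω hω => ?_
    simp only [Set.mem_ofPred_eq, hn ω, le_div_iff₀ hf] at hω ⊢
    refine le_trans ?_ (le_abs_self _)
    nlinarith [hω.1, hω.2]
  · intro y ε hε
    have hfε : 0 < f * ε / 2 := by positivity
    refine squeeze_zero' (Eventually.of_forall fun _ => measureReal_nonneg) ?_
      (hdiff y _ hfε)
    filter_upwards [hV y, (hlevel y).eventually_const_lt (u := f * y - f * ε / 2) (by linarith)]
      with n hn hlt
    refine measureReal_mono fun ω hω => ?_
    simp only [Set.mem_ofPred_eq, ← not_le, hn ω] at hω ⊢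
    rw [div_le_iff₀ hf, not_le] at hω
    refine le_trans ?_ (neg_le_abs _)
    nlinarith [hω.1, hω.2]

end OrderStatisticAsymptotics

/-! ### Central limit theorem for the trimean of exponential samples. -/

section TrimeanAsymptotics

/-- The general trimean of the quantiles of the standard exponential distribution. -/
noncomputable def expTrimean (α p : ℝ) : ℝ :=
  α / 2 * -Real.log (1 - p) + (1 - α) * -Real.log (1 - 1 / 2) + α / 2 * -Real.log (1 - (1 - p))

/-- The asymptotic variance of the general trimean of a sample from the standard exponential
distribution. -/
noncomputable def expTrimeanVariance (α p : ℝ) : ℝ :=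
  (α / 2) ^ 2 * (p / (1 - p)) + (1 - α) ^ 2 + (α / 2) ^ 2 * ((1 - p) / p)
    + 2 * (α / 2 * (1 - α) * (p / (1 - p)) + (α / 2) ^ 2 * (p / (1 - p)) + (1 - α) * (α / 2))

/-- The influence function of the general trimean at the standard exponential distribution. -/
noncomputable def expTrimeanInfluence (α p x : ℝ) : ℝ :=
  α / 2 * ((p - (Set.Iic (-Real.log (1 - p))).indicator (fun _ => (1 : ℝ)) x) / (1 - p))
  + (1 - α) * ((1 / 2 - (Set.Iic (-Real.log (1 - 1 / 2))).indicator (fun _ => 1) x) / (1 - 1 / 2))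
  + α / 2 * ((1 - p - (Set.Iic (-Real.log (1 - (1 - p)))).indicator (fun _ => 1) x)
      / (1 - (1 - p)))

instance : IsProbabilityMeasure (expMeasure 1) := isProbabilityMeasure_expMeasure one_pos

lemma measurable_expTrimeanInfluence (α p : ℝ) : Measurable (expTrimeanInfluence α p) := by
  unfold expTrimeanInfluence
  have h (x : ℝ) := measurable_indicator_Iic x
  exact (((((h _).const_sub _).div_const _).const_mul _).add
    ((((h _).const_sub _).div_const _).const_mul _)).add
    ((((h _).const_sub _).div_const _).const_mul _)

lemma integral_const_add_indicators {ν : Measure ℝ} [IsProbabilityMeasure ν] (A a b c x y z : ℝ) :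
    ∫ u, (A + a * (Set.Iic x).indicator (fun _ => (1 : ℝ)) u
      + b * (Set.Iic y).indicator (fun _ => 1) u + c * (Set.Iic z).indicator (fun _ => 1) u) ∂ν
      = A + a * cdf ν x + b * cdf ν y + c * cdf ν z := by
  have h (x a : ℝ) := (integrable_indicator_Iic (ν := ν) x).const_mul a
  have h1 : Integrable (fun u => A + a * (Set.Iic x).indicator (fun _ => (1 : ℝ)) u) ν :=
    (integrable_const A).add (h x a)
  have h2 : Integrable (fun u => A + a * (Set.Iic x).indicator (fun _ => (1 : ℝ)) u
      + b * (Set.Iic y).indicator (fun _ => 1) u) ν := h1.add (h y b)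
  rw [integral_add h2 (h z c), integral_add h1 (h y b), integral_add (integrable_const A) (h x a)]
  simp only [integral_const_mul, integral_indicator_Iic]
  simp

lemma integral_expTrimeanInfluence {α p : ℝ} (hp : p ∈ Set.Ioc (0 : ℝ) (1 / 2)) :
    ∫ x, expTrimeanInfluence α p x ∂(expMeasure 1) = 0 := by
  have h1 : 1 - p ≠ 0 := by linarith [hp.2]
  have h0 : p ≠ 0 := hp.1.ne'
  have key : ∀ x, expTrimeanInfluence α p x
      = (α / 2 * p / (1 - p) + (1 - α) + α / 2 * (1 - p) / p)
      + -(α / 2 / (1 - p)) * (Set.Iic (-Real.log (1 - p))).indicator (fun _ => (1 : ℝ)) x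
      + -(2 * (1 - α)) * (Set.Iic (-Real.log (1 - 1 / 2))).indicator (fun _ => 1) x
      + -(α / 2 / p) * (Set.Iic (-Real.log (1 - (1 - p)))).indicator (fun _ => 1) x := by
    intro x
    have h2 : 1 - (1 - p) = p := by ring
    simp only [expTrimeanInfluence, h2]
    field_simp
    ring
  simp only [key]
  rw [integral_const_add_indicators, cdf_expMeasure_neg_log ⟨hp.1, by linarith [hp.2]⟩,
    cdf_expMeasure_neg_log (by norm_num), cdf_expMeasure_neg_log ⟨by linarith [hp.2], by
      linarith [hp.1]⟩]
  field_simp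
  ring

/-- Since $p\le1/2$, the three half-lines are nested, so a product of two indicators is the smaller
one. The square is therefore again affine in the indicators, and only the values $p$, $1/2$, $1-p$
of the distribution function enter. -/
lemma integral_sq_expTrimeanInfluence {α p : ℝ} (hp : p ∈ Set.Ioc (0 : ℝ) (1 / 2)) :
    ∫ x, expTrimeanInfluence α p x ^ 2 ∂(expMeasure 1) = expTrimeanVariance α p := by
  have hp1 : 0 < 1 - p := by linarith [hp.2]
  have h1 : 1 - p ≠ 0 := hp1.ne'
  have h0 : p ≠ 0 := hp.1.ne'
  set A := α / 2 * p / (1 - p) + (1 - α) + α / 2 * (1 - p) / p with hA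
  set a := α / 2 / (1 - p) with ha
  set b := 2 * (1 - α) with hb
  set c := α / 2 / p with hc
  have hxy : -Real.log (1 - p) ≤ -Real.log (1 - 1 / 2) :=
    neg_le_neg (Real.log_le_log (by norm_num) (by linarith [hp.2]))
  have hyz : -Real.log (1 - 1 / 2) ≤ -Real.log (1 - (1 - p)) :=
    neg_le_neg (Real.log_le_log (by linarith [hp.1]) (by linarith [hp.2]))
  have key : ∀ x, expTrimeanInfluence α p x ^ 2 = A ^ 2
      + (a ^ 2 - 2 * A * a + 2 * a * b + 2 * a * c)
        * (Set.Iic (-Real.log (1 - p))).indicator (fun _ => (1 : ℝ)) x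
      + (b ^ 2 - 2 * A * b + 2 * b * c)
        * (Set.Iic (-Real.log (1 - 1 / 2))).indicator (fun _ => 1) x
      + (c ^ 2 - 2 * A * c)
        * (Set.Iic (-Real.log (1 - (1 - p)))).indicator (fun _ => 1) x := by
    intro x
    have h2 : 1 - (1 - p) = p := by ring
    have hlin : expTrimeanInfluence α p x = A
        - a * (Set.Iic (-Real.log (1 - p))).indicator (fun _ => (1 : ℝ)) x
        - b * (Set.Iic (-Real.log (1 - 1 / 2))).indicator (fun _ => 1) x
        - c * (Set.Iic (-Real.log (1 - (1 - p)))).indicator (fun _ => 1) x := by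
      simp only [expTrimeanInfluence, hA, ha, hb, hc, h2]
      field_simp
      ring
    rw [hlin]
    simp only [Set.indicator, Set.mem_Iic]
    split_ifs <;> first | (exfalso; linarith) | ring
  simp only [key]
  rw [integral_const_add_indicators, cdf_expMeasure_neg_log ⟨hp.1, by linarith [hp.2]⟩,
    cdf_expMeasure_neg_log (by norm_num), cdf_expMeasure_neg_log ⟨by linarith [hp.2], by
      linarith [hp.1]⟩, expTrimeanVariance, hA, ha, hb, hc]
  field_simp
  ring

variable {Ω : Type*} [MeasurableSpace Ω] {P : Measure Ω} [IsProbabilityMeasure P]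
  {X : ℕ → Ω → ℝ}

/-- The exponential density at its $q$-quantile is $1-q$. Rounding the rank down costs less than
$1$, hence less than $1/\sqrt n$ after normalization. -/
lemma tendstoInMeasure_sampleQuantile_sub (hlaw : ∀ i, HasLaw (X i) (expMeasure 1) P)
    (hind : iIndepFun X P) {q : ℝ} (hq : q ∈ Set.Ioo (0 : ℝ) 1) :
    TendstoInMeasure P (fun (n : ℕ) ω =>
      √n * (sampleQuantile (fun i : Fin n => X i ω) q - -Real.log (1 - q))
      - -empiricalDeviation (expMeasure 1) X (-Real.log (1 - q)) n ω / (1 - q)) atTop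
      fun _ => 0 := by
  have h1 : 0 < 1 - q := by linarith [hq.2]
  have hlog : 0 < -Real.log (1 - q) := neg_pos.2 (Real.log_neg h1 (by linarith [hq.1]))
  have hderiv := hasDerivAt_cdf_expMeasure hlog
  rw [neg_neg, Real.exp_log h1] at hderiv
  refine tendstoInMeasure_orderStat_sub hlaw hind h1 hderiv (k := fun n => ⌊(n : ℝ) * q⌋₊) ?_ ?_
  · filter_upwards [tendsto_natCast_atTop_atTop.eventually_ge_atTop (1 / q)] with n hn
    rw [div_le_iff₀ hq.1] at hn
    exact ⟨one_le_floor_mul le_rfl hn, floor_mul_le hq.2.le⟩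
  · rw [cdf_expMeasure_neg_log hq]
    refine squeeze_zero (fun n => ?_) (fun n => ?_) tendsto_sqrt_natCast_atTop.inv_tendsto_atTop
    · exact div_nonneg (sub_nonneg.2 (Nat.floor_le (mul_nonneg n.cast_nonneg hq.1.le)))
        (Real.sqrt_nonneg _)
    · rw [Pi.inv_apply, ← one_div]
      gcongr
      linarith [Nat.sub_one_lt_floor ((n : ℝ) * q)]

/-- The general trimean of a sample from the standard exponential distribution is asymptotically
normal. -/
theorem tendstoInDistribution_generalTrimean (hlaw : ∀ i, HasLaw (X i) (expMeasure 1) P)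
    (hind : iIndepFun X P) {α p : ℝ} (hα : α ∈ Set.Icc (0 : ℝ) 1)
    (hp : p ∈ Set.Ioc (0 : ℝ) (1 / 2)) (hv : 0 < expTrimeanVariance α p) :
    TendstoInDistribution (fun (n : ℕ) ω =>
      (generalTrimean α p (fun i : Fin n => X i ω) - expTrimean α p)
        / √(expTrimeanVariance α p / n)) atTop (id : ℝ → ℝ) (fun _ => P) (gaussianReal 0 1) := by
  set v := expTrimeanVariance α p with hvdef
  have hsv : 0 < √v := Real.sqrt_pos.2 hv
  have hh := measurable_expTrimeanInfluence α p
  have hcomp {g : ℝ → ℝ} (hg : Measurable g) (i : ℕ) :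
      ∫ ω, g (X i ω) ∂P = ∫ x, g x ∂(expMeasure 1) :=
    (hlaw i).integral_comp (f := g) hg.aestronglyMeasurable
  have hclt := tendstoInDistribution_inv_sqrt_mul_sum (P := P) (P' := gaussianReal 0 1)
    (X := fun i ω => expTrimeanInfluence α p (X i ω) / √v) (Y := id) HasLaw.id ?_ ?_ ?_ ?_
  · refine tendstoInDistribution_of_tendstoInMeasure_sub _ _ hclt ?_ fun n => ?_
    · have h := tendstoInMeasure_zero_weighted (P := P)
        (show 0 ≤ α / 2 by linarith [hα.1]) (show 0 ≤ 1 - α by linarith [hα.2])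
        (show 0 ≤ α / 2 by linarith [hα.1]) (by ring)
        (tendstoInMeasure_sampleQuantile_sub hlaw hind (q := p) ⟨hp.1, by linarith [hp.2]⟩)
        (tendstoInMeasure_sampleQuantile_sub hlaw hind (q := 1 / 2) (by norm_num))
        (tendstoInMeasure_sampleQuantile_sub hlaw hind (q := 1 - p)
          ⟨by linarith [hp.2], by linarith [hp.1]⟩)
      rw [tendstoInMeasure_iff_norm] at h ⊢
      intro ε hε
      refine (h (ε * √v) (by positivity)).congr fun n => ?_
      congr 1
      ext ω
      -- The normalized trimean minus the normalized influence sum is exactly the weighted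
      -- combination of the three Bahadur remainders, over $\sqrt v$.
      have hkey : ((fun (n : ℕ) ω => (generalTrimean α p (fun i : Fin n => X i ω) - expTrimean α p)
          / √(v / n)) - fun (n : ℕ) ω => (√n)⁻¹ * ∑ k ∈ Finset.range n,
          expTrimeanInfluence α p (X k ω) / √v) n ω
          = (α / 2 * (√n * (sampleQuantile (fun i : Fin n => X i ω) p - -Real.log (1 - p))
            - -empiricalDeviation (expMeasure 1) X (-Real.log (1 - p)) n ω / (1 - p))
          + (1 - α) * (√n * (sampleQuantile (fun i : Fin n => X i ω) (1 / 2)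
              - -Real.log (1 - 1 / 2))
            - -empiricalDeviation (expMeasure 1) X (-Real.log (1 - 1 / 2)) n ω / (1 - 1 / 2))
          + α / 2 * (√n * (sampleQuantile (fun i : Fin n => X i ω) (1 - p)
              - -Real.log (1 - (1 - p)))
            - -empiricalDeviation (expMeasure 1) X (-Real.log (1 - (1 - p))) n ω
              / (1 - (1 - p)))) / √v := by
        have hlin : ∑ k ∈ Finset.range n, expTrimeanInfluence α p (X k ω) / √v
            = √n * (α / 2 * (-empiricalDeviation (expMeasure 1) X (-Real.log (1 - p)) n ω / (1 - p))
              + (1 - α) * (-empiricalDeviation (expMeasure 1) X (-Real.log (1 - 1 / 2)) n ω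
                / (1 - 1 / 2))
              + α / 2 * (-empiricalDeviation (expMeasure 1) X (-Real.log (1 - (1 - p))) n ω
                / (1 - (1 - p)))) / √v := by
          rcases Nat.eq_zero_or_pos n with rfl | hn
          · simp
          have hs : √(n : ℝ) ≠ 0 := (Real.sqrt_pos.2 (by exact_mod_cast hn)).ne'
          rw [← Finset.sum_div]
          congr 1
          simp only [empiricalDeviation, expTrimeanInfluence,
            cdf_expMeasure_neg_log (p := p) ⟨hp.1, by linarith [hp.2]⟩,
            cdf_expMeasure_neg_log (p := 1 / 2) (by norm_num),
            cdf_expMeasure_neg_log (p := 1 - p) ⟨by linarith [hp.2], by linarith [hp.1]⟩]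
          simp only [Finset.sum_add_distrib, ← Finset.mul_sum, ← Finset.sum_div,
            Finset.sum_sub_distrib]
          field_simp
          ring
        simp only [Pi.sub_apply]
        rw [hlin, Real.sqrt_div hv.le, expTrimean, generalTrimean]
        rcases Nat.eq_zero_or_pos n with rfl | hn
        · simp [empiricalDeviation]
        have hs : √(n : ℝ) ≠ 0 := (Real.sqrt_pos.2 (by exact_mod_cast hn)).ne'
        have hi : (√(n : ℝ))⁻¹ * √n = 1 := inv_mul_cancel₀ hs
        rw [div_div_eq_mul_div, mul_div_assoc', ← mul_assoc (√(n : ℝ))⁻¹, hi, ← sub_div]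
        congr 1
        ring
      rw [Set.mem_ofPred_eq, Set.mem_ofPred_eq, hkey]
      simp only [Pi.zero_apply, sub_zero, norm_div, Real.norm_eq_abs, abs_of_pos hsv]
      rw [le_div_iff₀ hsv]
    · have hX : AEMeasurable (fun ω => fun i : Fin n => X i ω) P :=
        aemeasurable_pi_lambda _ fun i => (hlaw i).aemeasurable
      exact (((measurable_generalTrimean α p n).comp_aemeasurable hX).sub_const _).div_const _
  · rw [hcomp (g := fun x => expTrimeanInfluence α p x / √v) (hh.div_const _), integral_div,
      integral_expTrimeanInfluence hp, zero_div]
  · have := hcomp (g := fun x => (expTrimeanInfluence α p x / √v) ^ 2)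
      ((hh.div_const _).pow_const 2) 0
    simp only [div_pow, Real.sq_sqrt hv.le] at this
    simp only [Pi.pow_apply, div_pow, Real.sq_sqrt hv.le]
    rw [this, integral_div, integral_sq_expTrimeanInfluence hp, div_self hv.ne']
  · exact hind.comp (fun _ x => expTrimeanInfluence α p x / √v) fun _ => hh.div_const _
  · intro i
    have : IdentDistrib (X i) (X 0) P P :=
      ⟨(hlaw i).aemeasurable, (hlaw 0).aemeasurable, by rw [(hlaw i).map_eq, (hlaw 0).map_eq]⟩
    exact this.comp (hh.div_const _)

end TrimeanAsymptotics

/-! ### Convergence in mean of the logarithm of the trimean. -/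

section LogTrimean

lemma integral_sq_average_le {Ω : Type*} [MeasurableSpace Ω] {P : Measure Ω} {Y : ℕ → Ω → ℝ} {m : ℝ}
    (hY : ∀ i, MemLp (Y i) 2 P) (hm : ∀ i, ∫ ω, Y i ω ^ 2 ∂P ≤ m)
    (n : ℕ) (hn : 0 < n) :
    ∫ ω, ((∑ i ∈ Finset.range n, Y i ω) / n) ^ 2 ∂P ≤ m := by
  have hn0 : (0 : ℝ) < n := by exact_mod_cast hn
  have hint (i : ℕ) : Integrable (fun ω => Y i ω ^ 2) P := (hY i).integrable_sq
  have hS : MemLp (fun ω => (∑ i ∈ Finset.range n, Y i ω) / n) 2 P := by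
    have := (memLp_finsetSum (Finset.range n) fun i _ => hY i).mul_const (n : ℝ)⁻¹
    simpa only [div_eq_mul_inv] using this
  calc ∫ ω, ((∑ i ∈ Finset.range n, Y i ω) / n) ^ 2 ∂P
      ≤ ∫ ω, (∑ i ∈ Finset.range n, Y i ω ^ 2) / n ∂P := by
        refine integral_mono hS.integrable_sq
          ((integrable_finsetSum _ fun i _ => hint i).div_const _) fun ω => ?_
        have := sq_sum_le_card_mul_sum_sq (s := Finset.range n) (f := fun i => Y i ω)
        rw [Finset.card_range] at this
        simp only
        rw [div_pow, div_le_div_iff₀ (by positivity) hn0]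
        nlinarith
    _ = (∑ i ∈ Finset.range n, ∫ ω, Y i ω ^ 2 ∂P) / n := by
        rw [integral_div, integral_finsetSum _ fun i _ => hint i]
    _ ≤ (∑ i ∈ Finset.range n, m) / n := by gcongr; exact hm _
    _ = m := by simp; field_simp

variable {Ω : Type*} [MeasurableSpace Ω] {P : Measure Ω} [IsProbabilityMeasure P]
  {X : ℕ → Ω → ℝ}

lemma expTrimean_pos {α p : ℝ} (hα : α ∈ Set.Icc (0 : ℝ) 1) (hp : p ∈ Set.Ioc (0 : ℝ) (1 / 2)) :
    0 < expTrimean α p := by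
  have h (q : ℝ) (hq : q ∈ Set.Ioo (0 : ℝ) 1) : 0 < -Real.log (1 - q) :=
    neg_pos.2 (Real.log_neg (by linarith [hq.2]) (by linarith [hq.1]))
  have h1 := h p ⟨hp.1, by linarith [hp.2]⟩
  have h2 := h (1 / 2) (by norm_num)
  have h3 := h (1 - p) ⟨by linarith [hp.2], by linarith [hp.1]⟩
  rw [expTrimean]
  rcases hα.1.eq_or_lt with rfl | h0
  · linarith
  · have := mul_pos (half_pos h0) h1
    have := mul_pos (half_pos h0) h3
    have := mul_nonneg (sub_nonneg.2 hα.2) h2.le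
    linarith

lemma tendstoInMeasure_sampleQuantile (hlaw : ∀ i, HasLaw (X i) (expMeasure 1) P)
    (hind : iIndepFun X P) {q : ℝ} (hq : q ∈ Set.Ioo (0 : ℝ) 1) :
    TendstoInMeasure P (fun (n : ℕ) ω =>
      sampleQuantile (fun i : Fin n => X i ω) q - -Real.log (1 - q)) atTop fun _ => 0 := by
  have hf : 0 < 1 - q := by linarith [hq.2]
  have h := tendstoInMeasure_sampleQuantile_sub hlaw hind hq
  rw [tendstoInMeasure_iff_measureReal_norm] at h ⊢
  intro ε hε
  -- If the quantile error is at least $\varepsilon$, either the Bahadur remainder is at least $1$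
  -- or the empirical deviation is at least $c_n=(\varepsilon\sqrt n-1)(1-q)\to\infty$.
  set c : ℕ → ℝ := fun n => (ε * √(n : ℝ) - 1) * (1 - q) with hc
  have hclim : Tendsto c atTop atTop :=
    (tendsto_atTop_add_const_right _ (-1)
      (tendsto_sqrt_natCast_atTop.const_mul_atTop hε)).atTop_mul_const hf
  have hlim : Tendsto (fun n => 1 / c n ^ 2) atTop (𝓝 0) := by
    have := ((tendsto_pow_atTop two_ne_zero).comp hclim).inv_tendsto_atTop
    simp only [one_div]
    exact this
  have hsum := (h 1 one_pos).add hlim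
  rw [add_zero] at hsum
  refine squeeze_zero' (Eventually.of_forall fun _ => measureReal_nonneg) ?_ hsum
  filter_upwards [hclim.eventually_gt_atTop 0] with n hn
  refine le_trans (le_trans (measureReal_mono ?_) (measureReal_union_le _ _))
    (add_le_add le_rfl (measureReal_le_abs_empiricalDeviation hlaw hind (-Real.log (1 - q)) n hn))
  intro ω hω
  by_contra! hcon
  simp only [Set.mem_union, Set.mem_ofPred_eq, not_or, not_le, sub_zero, Real.norm_eq_abs]
    at hcon hω
  obtain ⟨h1, h2⟩ := hcon
  set y := sampleQuantile (fun i : Fin n => X i ω) q - -Real.log (1 - q)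
  set e := empiricalDeviation (expMeasure 1) X (-Real.log (1 - q)) n ω
  have h3 : |-e / (1 - q)| < ε * √(n : ℝ) - 1 := by
    rw [abs_div, abs_neg, abs_of_pos hf, div_lt_iff₀ hf]
    exact h2
  have h4 : |√(n : ℝ) * y| ≤ |√(n : ℝ) * y - -e / (1 - q)| + |-e / (1 - q)| := by
    have := abs_add_le (√(n : ℝ) * y - -e / (1 - q)) (-e / (1 - q))
    simpa using this
  rw [abs_mul, abs_of_nonneg (Real.sqrt_nonneg _)] at h4
  nlinarith [Real.sqrt_nonneg (n : ℝ)]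

lemma tendstoInMeasure_generalTrimean (hlaw : ∀ i, HasLaw (X i) (expMeasure 1) P)
    (hind : iIndepFun X P) {α p : ℝ} (hα : α ∈ Set.Icc (0 : ℝ) 1)
    (hp : p ∈ Set.Ioc (0 : ℝ) (1 / 2)) :
    TendstoInMeasure P (fun (n : ℕ) ω =>
      generalTrimean α p (fun i : Fin n => X i ω) - expTrimean α p) atTop fun _ => 0 := by
  have h := tendstoInMeasure_zero_weighted (P := P)
    (show 0 ≤ α / 2 by linarith [hα.1]) (show 0 ≤ 1 - α by linarith [hα.2])
    (show 0 ≤ α / 2 by linarith [hα.1]) (by ring)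
    (tendstoInMeasure_sampleQuantile hlaw hind (q := p) ⟨hp.1, by linarith [hp.2]⟩)
    (tendstoInMeasure_sampleQuantile hlaw hind (q := 1 / 2) (by norm_num))
    (tendstoInMeasure_sampleQuantile hlaw hind (q := 1 - p)
      ⟨by linarith [hp.2], by linarith [hp.1]⟩)
  convert h using 3 with n ω
  rw [generalTrimean, expTrimean]
  ring

/-- Convergence in probability to zero and boundedness in `L²` imply convergence in `L¹`. -/
lemma tendsto_integral_zero_of_bounded_sq {L : ℕ → Ω → ℝ} (h0 : ∀ n ω, 0 ≤ L n ω) {K : ℝ}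
    (hL : ∀ᶠ n in atTop, MemLp (L n) 2 P ∧ ∫ ω, L n ω ^ 2 ∂P ≤ K)
    (hprob : ∀ η : ℝ, 0 < η → Tendsto (fun n => P.real {ω | η ≤ L n ω}) atTop (𝓝 0)) :
    Tendsto (fun n => ∫ ω, L n ω ∂P) atTop (𝓝 0) := by
  refine tendsto_zero_of_forall_eventually_le (fun n => integral_nonneg (h0 n)) fun δ hδ => ?_
  -- Where $L\ge\delta/3$, use $L\le tL^2+1/(4t)$. This $t$ makes the quadratic part at most
  -- $\delta/3$; requiring probability at most $4t\delta/3$ makes the constant part at most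
  -- $\delta/3$.
  set t := δ / (3 * (|K| + 1)) with ht
  have ht0 : 0 < t := by positivity
  filter_upwards [hL, (hprob (δ / 3) (by positivity)).eventually_le_const
    (u := 4 * t * (δ / 3)) (by positivity)] with n hn hp
  obtain ⟨hn2, hnK⟩ := hn
  have hAE := hn2.1.aemeasurable
  have hset : NullMeasurableSet {ω | δ / 3 ≤ L n ω} P :=
    nullMeasurableSet_le aemeasurable_const hAE
  have hint1 : Integrable (fun ω => t * L n ω ^ 2) P := hn2.integrable_sq.const_mul t
  have hint2 : Integrable ({ω | δ / 3 ≤ L n ω}.indicator fun _ => 1 / (4 * t)) P :=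
    (integrable_const _).indicator₀ hset
  have hbound : ∀ ω, L n ω ≤ δ / 3 + t * L n ω ^ 2
      + {ω | δ / 3 ≤ L n ω}.indicator (fun _ => 1 / (4 * t)) ω := by
    intro ω
    by_cases hω : δ / 3 ≤ L n ω
    · rw [Set.indicator_of_mem (by exact hω)]
      have h1 : 0 ≤ (2 * t * L n ω - 1) ^ 2 / (4 * t) := by positivity
      have h2 : (2 * t * L n ω - 1) ^ 2 / (4 * t) = t * L n ω ^ 2 - L n ω + 1 / (4 * t) := by
        field_simp
        ring
      linarith
    · rw [Set.indicator_of_notMem (by exact hω)]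
      have := mul_nonneg ht0.le (sq_nonneg (L n ω))
      linarith
  have hint3 : Integrable (fun ω => δ / 3 + t * L n ω ^ 2) P := (integrable_const _).add hint1
  calc ∫ ω, L n ω ∂P ≤ ∫ ω, (δ / 3 + t * L n ω ^ 2
        + {ω | δ / 3 ≤ L n ω}.indicator (fun _ => 1 / (4 * t)) ω) ∂P :=
        integral_mono (hn2.integrable one_le_two) (hint3.add hint2) hbound
    _ = δ / 3 + t * ∫ ω, L n ω ^ 2 ∂P + P.real {ω | δ / 3 ≤ L n ω} * (1 / (4 * t)) := by
        rw [integral_add hint3 hint2, integral_add (integrable_const _) hint1,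
          integral_const_mul, integral_indicator₀ hset, setIntegral_const]
        simp
    _ ≤ δ / 3 + t * (|K| + 1) + 4 * t * (δ / 3) * (1 / (4 * t)) := by
        gcongr
        linarith [le_abs_self K]
    _ = δ := by
        rw [ht]
        field_simp
        ring

/-- The logarithm of the general trimean of a sample from the standard exponential distribution
converges in mean. -/
theorem tendsto_lintegral_abs_log_generalTrimean (hlaw : ∀ i, HasLaw (X i) (expMeasure 1) P)
    (hind : iIndepFun X P) {α p : ℝ} (hα : α ∈ Set.Icc (0 : ℝ) 1)
    (hp : p ∈ Set.Ioc (0 : ℝ) (1 / 2)) :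
    Tendsto (fun n : ℕ => ∫⁻ ω, ENNReal.ofReal
      |Real.log (generalTrimean α p (fun i : Fin n => X i ω)) - Real.log (expTrimean α p)| ∂P)
      atTop (𝓝 0) := by
  set c := expTrimean α p with hc
  have hc0 : 0 < c := expTrimean_pos hα hp
  set L : ℕ → Ω → ℝ := fun n ω =>
    |Real.log (generalTrimean α p (fun i : Fin n => X i ω)) - Real.log c| with hLdef
  have hL0 (n : ℕ) (ω : Ω) : 0 ≤ L n ω := abs_nonneg _
  set Y : ℕ → Ω → ℝ := fun i ω => |Real.log (X i ω)| with hY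
  have hYL (i : ℕ) : MemLp (Y i) 2 P := by
    have := ((hlaw i).map_eq ▸ memLp_log_expMeasure).comp_of_map (hlaw i).aemeasurable
    exact this.abs
  set m := ∫ x, Real.log x ^ 2 ∂(expMeasure 1) with hm
  have hYm (i : ℕ) : ∫ ω, Y i ω ^ 2 ∂P ≤ m := by
    simp only [hY, sq_abs]
    exact ((hlaw i).integral_comp (f := fun x => Real.log x ^ 2)
      (Real.measurable_log.pow_const 2).aestronglyMeasurable).le
  have hpos : ∀ᵐ ω ∂P, ∀ i, 0 < X i ω := ae_all_iff.2 fun i =>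
    ae_of_ae_map (p := fun x => 0 < x) (hlaw i).aemeasurable
      ((hlaw i).map_eq.symm ▸ ae_pos_expMeasure)
  have hLmeas (n : ℕ) : AEMeasurable (L n) P := by
    have hX : AEMeasurable (fun ω => fun i : Fin n => X i ω) P :=
      aemeasurable_pi_lambda _ fun i => (hlaw i).aemeasurable
    have := ((Real.measurable_log.comp_aemeasurable
      ((measurable_generalTrimean α p n).comp_aemeasurable hX)).sub_const (Real.log c))
    exact continuous_abs.measurable.comp_aemeasurable this
  -- For such $n$ the ranks are at least $1$, so no quantile takes the default value $0$ of
  -- `orderStat`.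
  have hlarge : ∀ᶠ n : ℕ in atTop, 1 ≤ n * (p / 2) := by
    filter_upwards [tendsto_natCast_atTop_atTop.eventually_ge_atTop (1 / (p / 2))] with n hn
    rwa [div_le_iff₀ (half_pos hp.1)] at hn
  have hbound : ∀ᶠ n : ℕ in atTop, MemLp (L n) 2 P ∧
      ∫ ω, L n ω ^ 2 ∂P ≤ 2 * Real.log c ^ 2 + 2 * (2 / p) ^ 2 * m := by
    filter_upwards [hlarge, eventually_gt_atTop 0] with n hn hn0
    set A : Ω → ℝ := fun ω => (∑ i ∈ Finset.range n, Y i ω) / n with hA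
    have hAL : MemLp A 2 P := by
      have := (memLp_finsetSum (Finset.range n) fun i _ => hYL i).mul_const (n : ℝ)⁻¹
      simp only [hA, div_eq_mul_inv]
      exact this
    have hle : ∀ᵐ ω ∂P, L n ω ≤ |Real.log c| + 2 / p * A ω := by
      filter_upwards [hpos] with ω hω
      have h1 := (abs_log_generalTrimean_le hα hp hn (x := fun i : Fin n => X i ω)
        fun i => hω i).2
      rw [← Finset.sum_range fun i => |Real.log (X i ω)|] at h1
      have h2 := abs_sub (Real.log (generalTrimean α p (fun i : Fin n => X i ω))) (Real.log c)
      simp only [hLdef, hA, hY]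
      linarith
    have hGL : MemLp (fun ω => |Real.log c| + 2 / p * A ω) 2 P :=
      (memLp_const (μ := P) |Real.log c|).add (hAL.const_mul (2 / p))
    have hL2 : MemLp (L n) 2 P := by
      refine hGL.mono (hLmeas n).aestronglyMeasurable ?_
      filter_upwards [hle] with ω hω
      rw [Real.norm_of_nonneg (hL0 n ω)]
      exact hω.trans (le_abs_self _)
    refine ⟨hL2, ?_⟩
    have hint : Integrable (fun ω => 2 * Real.log c ^ 2 + 2 * (2 / p) ^ 2 * A ω ^ 2) P :=
      (integrable_const (2 * Real.log c ^ 2)).add (hAL.integrable_sq.const_mul (2 * (2 / p) ^ 2))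
    calc ∫ ω, L n ω ^ 2 ∂P
        ≤ ∫ ω, (2 * Real.log c ^ 2 + 2 * (2 / p) ^ 2 * A ω ^ 2) ∂P := by
          refine integral_mono_ae hL2.integrable_sq hint ?_
          filter_upwards [hle] with ω hω
          have h1 : L n ω ^ 2 ≤ (|Real.log c| + 2 / p * A ω) ^ 2 :=
            pow_le_pow_left₀ (hL0 n ω) hω 2
          have h2 := sq_abs (Real.log c)
          nlinarith [sq_nonneg (|Real.log c| - 2 / p * A ω)]
      _ = 2 * Real.log c ^ 2 + 2 * (2 / p) ^ 2 * ∫ ω, A ω ^ 2 ∂P := by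
          rw [integral_add (integrable_const (2 * Real.log c ^ 2))
            (hAL.integrable_sq.const_mul (2 * (2 / p) ^ 2)),
            integral_const_mul (2 * (2 / p) ^ 2)]
          simp
      _ ≤ _ := by
          gcongr
          exact integral_sq_average_le hYL hYm n hn0
  have hprob (η : ℝ) (hη : 0 < η) : Tendsto (fun n => P.real {ω | η ≤ L n ω}) atTop (𝓝 0) := by
    obtain ⟨δ, hδ, hδη⟩ := Metric.continuousAt_iff.1 (Real.continuousAt_log hc0.ne') η hη
    have h := tendstoInMeasure_generalTrimean hlaw hind hα hp
    rw [tendstoInMeasure_iff_measureReal_norm] at h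
    refine squeeze_zero (fun _ => measureReal_nonneg) (fun n => ?_) (h δ hδ)
    refine measureReal_mono fun ω hω => ?_
    by_contra! hcon
    simp only [Set.mem_ofPred_eq, sub_zero, not_le] at hω hcon
    exact absurd (hδη hcon) (not_lt.2 hω)
  have hreal := tendsto_integral_zero_of_bounded_sq hL0 hbound hprob
  have := ENNReal.tendsto_ofReal hreal
  rw [ENNReal.ofReal_zero] at this
  refine this.congr' ?_
  filter_upwards [hbound] with n hn
  exact ofReal_integral_eq_lintegral_ofReal (hn.1.integrable one_le_two)
    (Eventually.of_forall (hL0 n))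

end LogTrimean

/-! ### Gaussianity of integrals of a Gaussian process. -/

section GaussianIntegral

variable {Ω : Type*} [MeasurableSpace Ω] {P : Measure Ω}

/-- A process with almost surely continuous paths is indistinguishable from a process with
measurable coordinates all of whose paths are continuous. -/
lemma exists_continuous_modification {B : ℝ → Ω → ℝ} (hm : ∀ t, AEMeasurable (B t) P)
    (hc : ∀ᵐ ω ∂P, Continuous fun t => B t ω) :
    ∃ B' : ℝ → Ω → ℝ, (∀ ω, Continuous fun t => B' t ω) ∧ (∀ t, Measurable (B' t)) ∧
      ∀ᵐ ω ∂P, ∀ t, B t ω = B' t ω := by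
  -- Countably many rational times share one null set; continuity of the paths extends measurability
  -- to all times.
  have hgood : ∀ᵐ ω ∂P, (Continuous fun t => B t ω) ∧
      ∀ q : ℚ, B q ω = (hm q).mk (B q) ω :=
    hc.and (ae_all_iff.2 fun q => (hm q).ae_eq_mk)
  obtain ⟨s, hs_sub, hs_meas, hs_null⟩ := exists_measurable_superset_of_null hgood
  have hs (ω : Ω) (hω : ω ∉ s) : (Continuous fun t => B t ω) ∧
      ∀ q : ℚ, B q ω = (hm q).mk (B q) ω := by
    by_contra h
    exact hω (hs_sub h)
  have hcont (ω : Ω) : Continuous fun t => sᶜ.indicator (B t) ω := by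
    by_cases hω : ω ∈ s
    · simp only [Set.indicator_of_notMem (Set.notMem_compl_iff.2 hω)]
      exact continuous_const
    · simp only [Set.indicator_of_mem (Set.mem_compl hω)]
      exact (hs ω hω).1
  have hrat (q : ℚ) : Measurable (sᶜ.indicator (B q)) := by
    have : sᶜ.indicator (B q) = sᶜ.indicator ((hm q).mk (B q)) :=
      Set.indicator_congr fun ω hω => (hs ω hω).2 q
    rw [this]
    exact (hm q).measurable_mk.indicator hs_meas.compl
  refine ⟨fun t => sᶜ.indicator (B t), hcont, fun t => ?_, ?_⟩
  · obtain ⟨q, hq⟩ : ∃ q : ℕ → ℚ, Tendsto (fun n => (q n : ℝ)) atTop (𝓝 t) := by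
      have := mem_closure_iff_seq_limit.1 (Rat.denseRange_cast (𝕜 := ℝ) t)
      obtain ⟨x, hx, hlim⟩ := this
      choose q hq using hx
      exact ⟨q, by simpa only [hq] using hlim⟩
    refine measurable_of_tendsto_metrizable (fun n => hrat (q n)) ?_
    rw [tendsto_pi_nhds]
    intro ω
    exact ((hcont ω).tendsto t).comp hq
  · have : ∀ᵐ ω ∂P, ω ∉ s := measure_eq_zero_iff_ae_notMem.1 hs_null
    filter_upwards [this] with ω hω t
    exact (Set.indicator_of_mem (Set.mem_compl hω) _).symm

variable [IsProbabilityMeasure P] {B : ℝ → Ω → ℝ} {φ : ℝ → ℝ}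

/-- The weight $1/(1+|t|)$ offsets one factor of the variance bound $(1+|t|)^2$, leaving the
integrable $(1+|t|)|\varphi(t)|$. -/
lemma integrable_sq_mul_div_one_add_abs (hB : Measurable (Function.uncurry B))
    (hBL : ∀ t, MemLp (B t) 2 P) (hBv : ∀ t, ∫ ω, B t ω ^ 2 ∂P ≤ (1 + |t|) ^ 2)
    (hφ : AEStronglyMeasurable φ) (hφi : Integrable fun t => (1 + |t|) * |φ t|) :
    Integrable (fun p : ℝ × Ω => B p.1 p.2 ^ 2 * (|φ p.1| / (1 + |p.1|))) (volume.prod P) := by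
  have hmeas : AEStronglyMeasurable (fun p : ℝ × Ω => B p.1 p.2 ^ 2 * (|φ p.1| / (1 + |p.1|)))
      (volume.prod P) := by
    have h1 : Measurable fun p : ℝ × Ω => B p.1 p.2 ^ 2 := hB.pow_const 2
    have h2 : AEStronglyMeasurable (fun t => |φ t| / (1 + |t|)) := by
      have h3 : AEMeasurable (fun t : ℝ => 1 + |t|) := by fun_prop
      exact (hφ.norm.aemeasurable.div h3).aestronglyMeasurable
    exact h1.aestronglyMeasurable.mul h2.comp_fst
  rw [integrable_prod_iff hmeas]
  refine ⟨Eventually.of_forall fun t => (hBL t).integrable_sq.mul_const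
    (|φ t| / (1 + |t|)), ?_⟩
  refine hφi.mono' hmeas.norm.integral_prod_right' (Eventually.of_forall fun t => ?_)
  have h1 : 0 < 1 + |t| := by positivity
  have h2 : ∀ ω, ‖B t ω ^ 2 * (|φ t| / (1 + |t|))‖ = B t ω ^ 2 * (|φ t| / (1 + |t|)) := fun ω =>
    Real.norm_of_nonneg (by positivity)
  simp only [h2]
  rw [integral_mul_const, Real.norm_of_nonneg (mul_nonneg (integral_nonneg fun _ => sq_nonneg _)
    (by positivity))]
  calc (∫ ω, B t ω ^ 2 ∂P) * (|φ t| / (1 + |t|)) ≤ (1 + |t|) ^ 2 * (|φ t| / (1 + |t|)) := by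
        gcongr; exact hBv t
    _ = (1 + |t|) * |φ t| := by field_simp

/-- Weighted arithmetic-geometric inequality: $2|B\varphi Y|\le
B^2|\varphi|/(1+|t|)+(1+|t|)|\varphi|Y^2$. It justifies Fubini's theorem against any $Y\in L^2$. -/
lemma integrable_mul_mul_prod (hB : Measurable (Function.uncurry B))
    (hBL : ∀ t, MemLp (B t) 2 P) (hBv : ∀ t, ∫ ω, B t ω ^ 2 ∂P ≤ (1 + |t|) ^ 2)
    (hφ : AEStronglyMeasurable φ) (hφi : Integrable fun t => (1 + |t|) * |φ t|)
    {Y : Ω → ℝ} (hY : MemLp Y 2 P) :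
    Integrable (fun p : ℝ × Ω => B p.1 p.2 * φ p.1 * Y p.2) (volume.prod P) := by
  have h1 := integrable_sq_mul_div_one_add_abs hB hBL hBv hφ hφi
  have h2 : Integrable (fun p : ℝ × Ω => ((1 + |p.1|) * |φ p.1|) * Y p.2 ^ 2) (volume.prod P) :=
    hφi.mul_prod hY.integrable_sq
  refine (h1.add h2).mono' ?_ (Eventually.of_forall fun p => ?_)
  · have h1 : Measurable fun p : ℝ × Ω => B p.1 p.2 := hB
    exact (h1.aestronglyMeasurable.mul hφ.comp_fst).mul hY.1.comp_snd
  · have h3 : 0 < 1 + |p.1| := by positivity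
    rw [Real.norm_eq_abs, abs_mul, abs_mul, Pi.add_apply]
    have h4 : 0 ≤ |φ p.1| / (1 + |p.1|) * (|B p.1 p.2| - (1 + |p.1|) * |Y p.2|) ^ 2 := by
      positivity
    have h5 : |φ p.1| / (1 + |p.1|) * (|B p.1 p.2| - (1 + |p.1|) * |Y p.2|) ^ 2
        = B p.1 p.2 ^ 2 * (|φ p.1| / (1 + |p.1|)) + (1 + |p.1|) * |φ p.1| * Y p.2 ^ 2
          - 2 * (|B p.1 p.2| * |φ p.1| * |Y p.2|) := by
      rw [← sq_abs (B p.1 p.2), ← sq_abs (Y p.2)]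
      field_simp
      ring
    have h6 : 0 ≤ |B p.1 p.2| * |φ p.1| * |Y p.2| := by positivity
    linarith

lemma ae_integrable_path_mul (hB : Measurable (Function.uncurry B))
    (hBL : ∀ t, MemLp (B t) 2 P) (hBv : ∀ t, ∫ ω, B t ω ^ 2 ∂P ≤ (1 + |t|) ^ 2)
    (hφ : AEStronglyMeasurable φ) (hφi : Integrable fun t => (1 + |t|) * |φ t|) :
    ∀ᵐ ω ∂P, Integrable fun t => B t ω * φ t := by
  have := (integrable_mul_mul_prod hB hBL hBv hφ hφi (memLp_const (1 : ℝ))).prod_left_ae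
  simpa using this

lemma integral_path_mul_mul (hB : Measurable (Function.uncurry B))
    (hBL : ∀ t, MemLp (B t) 2 P) (hBv : ∀ t, ∫ ω, B t ω ^ 2 ∂P ≤ (1 + |t|) ^ 2)
    (hφ : AEStronglyMeasurable φ) (hφi : Integrable fun t => (1 + |t|) * |φ t|)
    {Y : Ω → ℝ} (hY : MemLp Y 2 P) :
    ∫ ω, (∫ t, B t ω * φ t) * Y ω ∂P = ∫ t, φ t * ∫ ω, B t ω * Y ω ∂P := by
  have h := integral_integral_swap (f := fun t ω => B t ω * φ t * Y ω)
    (integrable_mul_mul_prod hB hBL hBv hφ hφi hY)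
  simp only [← integral_mul_const, ← integral_const_mul]
  rw [← h]
  congr 1 with t
  congr 1 with ω
  ring

lemma memLp_integral_path_mul (hB : Measurable (Function.uncurry B))
    (hBL : ∀ t, MemLp (B t) 2 P) (hBv : ∀ t, ∫ ω, B t ω ^ 2 ∂P ≤ (1 + |t|) ^ 2)
    (hφ : AEStronglyMeasurable φ) (hφi : Integrable fun t => (1 + |t|) * |φ t|) :
    MemLp (fun ω => ∫ t, B t ω * φ t) 2 P := by
  have hi := integrable_mul_mul_prod hB hBL hBv hφ hφi (memLp_const (1 : ℝ))
  simp only [mul_one] at hi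
  have hmeas : AEStronglyMeasurable (fun ω => ∫ t, B t ω * φ t) P :=
    hi.integral_prod_right.aestronglyMeasurable
  have hsq := integrable_sq_mul_div_one_add_abs hB hBL hBv hφ hφi
  rw [memLp_two_iff_integrable_sq hmeas]
  set Z := ∫ t, (1 + |t|) * |φ t| with hZ
  have hZ0 : 0 ≤ Z := integral_nonneg fun t => by positivity
  refine (hsq.integral_prod_right.const_mul (Z + 1)).mono' (hmeas.pow 2) ?_
  filter_upwards [hi.prod_left_ae, hsq.prod_left_ae] with ω h1 h2
  rw [Real.norm_of_nonneg (sq_nonneg _)]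
  set x := ∫ t, B t ω * φ t
  set q := ∫ t, B t ω ^ 2 * (|φ t| / (1 + |t|))
  -- Weighted Cauchy–Schwarz from the nonnegative quadratic $q-2yx+y^2Z$; using $Z+1$ in place of
  -- the minimizer's $Z$ avoids dividing by zero and still gives $x^2\le(Z+1)q$.
  set y := x / (Z + 1) with hy
  have hpos : 0 ≤ ∫ t, (B t ω ^ 2 * (|φ t| / (1 + |t|)) - 2 * y * (B t ω * φ t)
      + y ^ 2 * ((1 + |t|) * |φ t|)) := by
    refine integral_nonneg fun t => ?_
    have h3 : 0 < 1 + |t| := by positivity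
    rcases le_total 0 (φ t) with h | h
    · have : 0 ≤ |φ t| / (1 + |t|) * (B t ω - y * (1 + |t|)) ^ 2 := by positivity
      refine this.trans_eq ?_
      rw [abs_of_nonneg h]
      field_simp
      ring
    · have : 0 ≤ |φ t| / (1 + |t|) * (B t ω + y * (1 + |t|)) ^ 2 := by positivity
      refine this.trans_eq ?_
      rw [abs_of_nonpos h]
      field_simp
      ring
  have h3 : Integrable fun t => B t ω ^ 2 * (|φ t| / (1 + |t|)) - 2 * y * (B t ω * φ t) :=
    h2.sub (h1.const_mul (2 * y))
  rw [integral_add h3 (hφi.const_mul (y ^ 2)), integral_sub h2 (h1.const_mul (2 * y)),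
    integral_const_mul, integral_const_mul] at hpos
  change 0 ≤ q - 2 * y * x + y ^ 2 * Z at hpos
  have hx : x = y * (Z + 1) := by rw [hy]; field_simp
  rw [hx] at hpos ⊢
  nlinarith [sq_nonneg y]

lemma hasLaw_gaussianReal_of_mem_span (hG : IsGaussianProcess B P)
    (hBL : ∀ t, MemLp (B t) 2 P) (h0 : ∀ t, ∫ ω, B t ω ∂P = 0) {y : Lp ℝ 2 P}
    (hy : y ∈ Submodule.span ℝ (Set.range fun t => (hBL t).toLp (B t))) :
    HasLaw y (gaussianReal 0 (‖y‖ ^ 2).toNNReal) P := by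
  obtain ⟨c, rfl⟩ := (Finsupp.mem_span_range_iff_exists_finsupp).1 hy
  set y : Lp ℝ 2 P := c.sum fun t a => a • (hBL t).toLp (B t) with hydef
  have hae : (y : Ω → ℝ) =ᵐ[P] fun ω => ∑ t ∈ c.support, c t • B t ω := by
    have h1 : (y : Ω → ℝ) =ᵐ[P] ∑ t ∈ c.support, ((c t • (hBL t).toLp (B t) : Lp ℝ 2 P) : Ω → ℝ) :=
      Lp.coeFn_finsetSum _ _
    have h2 : ∀ᵐ ω ∂P, ∀ t ∈ c.support,
        ((c t • (hBL t).toLp (B t) : Lp ℝ 2 P) : Ω → ℝ) ω = c t • B t ω := by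
      refine (ae_ball_iff c.support.countable_toSet).2 fun t _ => ?_
      filter_upwards [Lp.coeFn_smul (c t) ((hBL t).toLp (B t)), (hBL t).coeFn_toLp] with ω h3 h4
      rw [h3, Pi.smul_apply, h4]
    filter_upwards [h1, h2] with ω h3 h4
    rw [h3, Finset.sum_apply]
    exact Finset.sum_congr rfl h4
  have hgl : HasGaussianLaw (y : Ω → ℝ) P :=
    ((hG.smul c).hasGaussianLaw_fun_sum (I := c.support)).congr hae.symm
  have hmean : ∫ ω, y ω ∂P = 0 := by
    rw [integral_congr_ae hae, integral_finsetSum]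
    · refine Finset.sum_eq_zero fun t _ => ?_
      rw [integral_smul, h0, smul_zero]
    · exact fun t _ => ((hBL t).integrable one_le_two).smul (c t)
  have hvar : variance y P = ‖y‖ ^ 2 := by
    rw [variance_of_integral_eq_zero hgl.aemeasurable hmean, ← real_inner_self_eq_norm_sq,
      L2.inner_def]
    congr 1 with ω
    simp [sq]
  exact ⟨hgl.aemeasurable, by rw [hgl.map_eq_gaussianReal, hmean, hvar]⟩

/-- The characteristic functions depend only on the $L^2$ norms, which converge; the limit law is
identified by its own characteristic function. -/
lemma hasLaw_gaussianReal_of_tendsto_Lp {y : ℕ → Lp ℝ 2 P} {x : Lp ℝ 2 P}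
    (hlim : Tendsto y atTop (𝓝 x))
    (hy : ∀ n, HasLaw (y n) (gaussianReal 0 (‖y n‖ ^ 2).toNNReal) P) :
    HasLaw x (gaussianReal 0 (‖x‖ ^ 2).toNNReal) P := by
  have hx : AEMeasurable x P := (Lp.aestronglyMeasurable x).aemeasurable
  refine ⟨hx, ?_⟩
  have hdist := (tendstoInMeasure_of_tendsto_Lp hlim).tendstoInDistribution_of_aemeasurable
    (fun n => (hy n).aemeasurable) hx
  have := Measure.isProbabilityMeasure_map hx (μ := P)
  refine Measure.ext_of_charFun (funext fun u => ?_)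
  have h1 := ProbabilityMeasure.tendsto_iff_tendsto_charFun.1 hdist.tendsto u
  refine tendsto_nhds_unique h1 ?_
  have h2 (n : ℕ) : charFun (P.map (y n)) u
      = Complex.exp (((-(‖y n‖ ^ 2 * u ^ 2 / 2) : ℝ)) : ℂ) := by
    rw [(hy n).map_eq, charFun_gaussianReal, Real.coe_toNNReal _ (sq_nonneg _)]
    congr 1
    push_cast
    ring
  have h3 : charFun (gaussianReal 0 (‖x‖ ^ 2).toNNReal) u
      = Complex.exp (((-(‖x‖ ^ 2 * u ^ 2 / 2) : ℝ)) : ℂ) := by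
    rw [charFun_gaussianReal, Real.coe_toNNReal _ (sq_nonneg _)]
    congr 1
    push_cast
    ring
  simp only [ProbabilityMeasure.coe_mk, h2, h3]
  refine (Complex.continuous_exp.tendsto _).comp ((Complex.continuous_ofReal.tendsto _).comp ?_)
  exact ((((hlim.norm).pow 2).mul_const _).div_const _).neg

/-- An integral of a centred Gaussian process against a deterministic weight is Gaussian. -/
theorem hasLaw_integral_path_mul (hG : IsGaussianProcess B P)
    (hB : Measurable (Function.uncurry B)) (h0 : ∀ t, ∫ ω, B t ω ∂P = 0)
    (hBv : ∀ t, ∫ ω, B t ω ^ 2 ∂P ≤ (1 + |t|) ^ 2)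
    (hφ : AEStronglyMeasurable φ) (hφi : Integrable fun t => (1 + |t|) * |φ t|) :
    HasLaw (fun ω => ∫ t, B t ω * φ t)
      (gaussianReal 0 (∫ t, φ t * ∫ s, φ s * ∫ ω, B s ω * B t ω ∂P).toNNReal) P := by
  have hBL (t : ℝ) : MemLp (B t) 2 P := (hG.hasGaussianLaw_eval t).memLp_two
  set X : Ω → ℝ := fun ω => ∫ t, B t ω * φ t with hX
  have hXL : MemLp X 2 P := memLp_integral_path_mul hB hBL hBv hφ hφi
  set S := Submodule.span ℝ (Set.range fun t => (hBL t).toLp (B t)) with hS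
  -- The closure is the double orthogonal complement: by Fubini, whatever is orthogonal to every
  -- $B_t$ is orthogonal to the integral. No Riemann sums are needed.
  have hmem : hXL.toLp X ∈ S.topologicalClosure := by
    rw [← Submodule.orthogonal_orthogonal_eq_closure, Submodule.mem_orthogonal]
    intro u hu
    rw [Submodule.mem_orthogonal] at hu
    have hzero (t : ℝ) : ∫ ω, B t ω * u ω ∂P = 0 := by
      have := hu _ (Submodule.subset_span ⟨t, rfl⟩)
      rw [L2.inner_def] at this
      rw [← this]
      refine integral_congr_ae ?_
      filter_upwards [(hBL t).coeFn_toLp] with ω hω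
      rw [hω]
      simp [mul_comm]
    have hswap := integral_path_mul_mul hB hBL hBv hφ hφi (Lp.memLp u)
    simp only [hzero, mul_zero, integral_zero] at hswap
    rw [L2.inner_def, ← hswap]
    refine integral_congr_ae ?_
    filter_upwards [hXL.coeFn_toLp] with ω hω
    rw [hω]
    simp [hX]
  obtain ⟨y, hyS, hlim⟩ := mem_closure_iff_seq_limit.1 hmem
  have hlaw := hasLaw_gaussianReal_of_tendsto_Lp hlim
    fun n => hasLaw_gaussianReal_of_mem_span hG hBL h0 (hyS n)
  have hnorm : ‖hXL.toLp X‖ ^ 2 = ∫ t, φ t * ∫ s, φ s * ∫ ω, B s ω * B t ω ∂P := by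
    have h1 : ‖hXL.toLp X‖ ^ 2 = ∫ ω, X ω * X ω ∂P := by
      rw [← real_inner_self_eq_norm_sq, L2.inner_def]
      refine integral_congr_ae ?_
      filter_upwards [hXL.coeFn_toLp] with ω hω
      rw [hω]
      simp [sq]
    rw [h1, integral_path_mul_mul hB hBL hBv hφ hφi hXL]
    congr 1 with t
    rw [← integral_path_mul_mul hB hBL hBv hφ hφi (hBL t)]
    simp only [hX, mul_comm]
  rw [hnorm] at hlaw
  exact hlaw.congr hXL.coeFn_toLp.symm

end GaussianIntegral

/-! ### Law of the wavelet coefficients of fractional Brownian motion. -/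

section FractionalBrownianMotion

/-- The variance of the wavelet coefficient of a fractional Brownian motion at level `0` and
location `0`, as a double integral of the covariance function. -/
noncomputable def fbmCoeffVariance (H : ℝ) (ψ : ℝ → ℝ) : ℝ :=
  ∫ t, ψ t * ∫ s, ψ s * ((|s| ^ (2 * H) + |t| ^ (2 * H) - |s - t| ^ (2 * H)) / 2)

lemma ndwtCoeff_zero_zero {Ω : Type*} {B : ℝ → Ω → ℝ} {ψ : ℝ → ℝ} (ω : Ω) :
    ndwtCoeff ψ B 0 0 ω = ∫ t, B t ω * ψ t := by
  simp [ndwtCoeff]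

variable {Ω : Type*} [MeasurableSpace Ω] {P : Measure Ω} {H : ℝ} {B : ℝ → Ω → ℝ} {ψ : ℝ → ℝ}

lemma IsFractionalBrownianMotion.isProbabilityMeasure (hB : IsFractionalBrownianMotion H B P) :
    IsProbabilityMeasure P :=
  hB.isGaussianProcess.isProbabilityMeasure

lemma IsFractionalBrownianMotion.memLp_two (hB : IsFractionalBrownianMotion H B P) (t : ℝ) :
    MemLp (B t) 2 P :=
  (hB.isGaussianProcess.hasGaussianLaw_eval t).memLp_two

lemma IsFractionalBrownianMotion.integral_mul (hB : IsFractionalBrownianMotion H B P) (s t : ℝ) :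
    ∫ ω, B s ω * B t ω ∂P = (|s| ^ (2 * H) + |t| ^ (2 * H) - |s - t| ^ (2 * H)) / 2 := by
  have := hB.isProbabilityMeasure
  have h := covariance_eq_sub (hB.memLp_two s) (hB.memLp_two t)
  rw [hB.covariance_eq, hB.mean_eq_zero, zero_mul, sub_zero] at h
  exact h.symm

lemma IsFractionalBrownianMotion.integral_sq_le (hB : IsFractionalBrownianMotion H B P)
    (hH : H ∈ Set.Ioo (0 : ℝ) 1) (t : ℝ) : ∫ ω, B t ω ^ 2 ∂P ≤ (1 + |t|) ^ 2 := by
  have h := hB.integral_mul t t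
  rw [sub_self, abs_zero, Real.zero_rpow (by linarith [hH.1]), sub_zero, add_self_div_two] at h
  simp only [sq (B t _), h]
  calc |t| ^ (2 * H) ≤ (1 + |t|) ^ (2 * H) :=
        Real.rpow_le_rpow (abs_nonneg t) (by linarith) (by linarith [hH.1])
    _ ≤ (1 + |t|) ^ (2 : ℝ) :=
        Real.rpow_le_rpow_of_exponent_le (by linarith [abs_nonneg t]) (by linarith [hH.2])
    _ = (1 + |t|) ^ 2 := Real.rpow_ofNat _ _

lemma IsFractionalBrownianMotion.congr {B' : ℝ → Ω → ℝ} (hB : IsFractionalBrownianMotion H B P)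
    (h : ∀ᵐ ω ∂P, ∀ t, B t ω = B' t ω) : IsFractionalBrownianMotion H B' P := by
  have ht (t : ℝ) : B t =ᵐ[P] B' t := h.mono fun ω hω => hω t
  refine ⟨hB.isGaussianProcess.congr ht, fun t => ?_, fun s t => ?_, ?_⟩
  · rw [← integral_congr_ae (ht t), hB.mean_eq_zero]
  · rw [← hB.covariance_eq s t, covariance, covariance, ← integral_congr_ae (ht s),
      ← integral_congr_ae (ht t)]
    refine integral_congr_ae ?_
    filter_upwards [h] with ω hω
    rw [hω s, hω t]
  · filter_upwards [h, hB.continuous_paths] with ω h1 h2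
    simpa only [h1] using h2

lemma integrable_one_add_abs_mul_abs (hψ : Integrable ψ) (hψ' : Integrable fun t => t * ψ t) :
    Integrable fun t => (1 + |t|) * |ψ t| := by
  refine (hψ.abs.add hψ'.abs).congr (Eventually.of_forall fun t => ?_)
  simp only [Pi.add_apply, abs_mul]
  ring

/-- A continuous modification supplies joint measurability without changing the path integrals
almost surely. The variance involves only $H$ and $\psi$, so the rescaled process yields the same
law. -/
lemma IsFractionalBrownianMotion.ae_integrable_and_hasLaw
    (hB : IsFractionalBrownianMotion H B P) (hH : H ∈ Set.Ioo (0 : ℝ) 1) (hψ : Integrable ψ)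
    (hψ' : Integrable fun t => t * ψ t) :
    (∀ᵐ ω ∂P, Integrable fun t => B t ω * ψ t) ∧
      HasLaw (ndwtCoeff ψ B 0 0) (gaussianReal 0 (fbmCoeffVariance H ψ).toNNReal) P := by
  have := hB.isProbabilityMeasure
  obtain ⟨B', hcont, hmeas, hae⟩ := exists_continuous_modification
    (fun t => hB.isGaussianProcess.aemeasurable t) hB.continuous_paths
  have hB' := hB.congr hae
  have hunc : Measurable (Function.uncurry B') :=
    measurable_uncurry_of_continuous_of_measurable hcont hmeas
  have hψi := integrable_one_add_abs_mul_abs hψ hψ'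
  constructor
  · filter_upwards [hae, ae_integrable_path_mul hunc hB'.memLp_two (hB'.integral_sq_le hH) hψ.1 hψi]
      with ω h1 h2
    simpa only [h1] using h2
  · have hlaw := hasLaw_integral_path_mul hB'.isGaussianProcess hunc hB'.mean_eq_zero
      (hB'.integral_sq_le hH) hψ.1 hψi
    simp only [hB'.integral_mul] at hlaw
    refine hlaw.congr ?_
    filter_upwards [hae] with ω hω
    rw [ndwtCoeff_zero_zero]
    simp only [hω]

/-- The increments of a fractional Brownian motion after time `s`, rescaled, form again a fractional
Brownian motion. -/
lemma IsFractionalBrownianMotion.rescale (hB : IsFractionalBrownianMotion H B P) (hH : 0 < H)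
    (s : ℝ) {a : ℝ} (ha : 0 < a) :
    IsFractionalBrownianMotion H (fun u ω => a ^ H * (B (s + a⁻¹ * u) ω - B s ω)) P := by
  have := hB.isProbabilityMeasure
  have hmean (t : ℝ) : ∫ ω, (B t ω - B s ω) ∂P = 0 := by
    rw [integral_sub ((hB.memLp_two t).integrable one_le_two)
      ((hB.memLp_two s).integrable one_le_two), hB.mean_eq_zero, hB.mean_eq_zero, sub_zero]
  refine ⟨?_, fun t => ?_, fun u v => ?_, ?_⟩
  · exact ((hB.isGaussianProcess.shift s).comp_right fun u => a⁻¹ * u).smul fun _ => a ^ H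
  · rw [integral_const_mul, hmean, mul_zero]
  · have hL := hB.memLp_two
    have hscale (w : ℝ) : |a⁻¹ * w| ^ (2 * H) = (a ^ H * a ^ H)⁻¹ * |w| ^ (2 * H) := by
      rw [abs_mul, abs_of_pos (inv_pos.2 ha), Real.mul_rpow (inv_pos.2 ha).le (abs_nonneg w),
        Real.inv_rpow ha.le, two_mul, Real.rpow_add ha]
    have h1 : s + a⁻¹ * u - s = a⁻¹ * u := by ring
    have h2 : s - (s + a⁻¹ * v) = a⁻¹ * -v := by ring
    have h3 : s + a⁻¹ * u - (s + a⁻¹ * v) = a⁻¹ * (u - v) := by ring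
    have h4 : a ^ H ≠ 0 := (Real.rpow_pos_of_pos ha H).ne'
    rw [covariance_const_mul_left, covariance_const_mul_right,
      covariance_fun_sub_fun_sub (hL _) (hL _) (hL _) (hL _), hB.covariance_eq, hB.covariance_eq,
      hB.covariance_eq, hB.covariance_eq, h1, h2, h3, hscale, hscale, hscale, abs_neg, sub_self,
      abs_zero, Real.zero_rpow (by positivity)]
    field_simp
    ring
  · filter_upwards [hB.continuous_paths] with ω hω
    fun_prop

/-- Substitute $u=2^j(t-s)$; since $\int\psi=0$, subtracting $B_s$ changes nothing. With $a=2^j$,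
the factor is $a^{1/2}a^{-1}a^{-H}$. -/
lemma ndwtCoeff_eq_mul_rescale {Ω : Type*} {B : ℝ → Ω → ℝ} {ψ : ℝ → ℝ} (H : ℝ) (hψ : Integrable ψ)
    (hψ_zero : ∫ t, ψ t = 0) (j : ℕ) (s : ℝ) (ω : Ω)
    (hint : Integrable fun u =>
      ((2 : ℝ) ^ j) ^ H * (B (s + ((2 : ℝ) ^ j)⁻¹ * u) ω - B s ω) * ψ u) :
    ndwtCoeff ψ B j s ω = (2 : ℝ) ^ (-((j : ℝ) / 2) - j * H) *
      ndwtCoeff ψ (fun u ω => ((2 : ℝ) ^ j) ^ H * (B (s + ((2 : ℝ) ^ j)⁻¹ * u) ω - B s ω))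
        0 0 ω := by
  set a : ℝ := (2 : ℝ) ^ j with ha
  have ha0 : 0 < a := by positivity
  have haH : 0 < a ^ H := Real.rpow_pos_of_pos ha0 H
  set g : ℝ → ℝ := fun u => B (s + a⁻¹ * u) ω * ψ u with hg
  have hmain : ∫ u, a ^ H * (B (s + a⁻¹ * u) ω - B s ω) * ψ u = a ^ H * ∫ u, g u := by
    have h1 : Integrable fun u => a ^ H * B s ω * ψ u := hψ.const_mul _
    have h2 : ∫ u, a ^ H * B s ω * ψ u = 0 := by
      rw [integral_const_mul, hψ_zero, mul_zero]
    rw [← add_zero (∫ u, a ^ H * (B (s + a⁻¹ * u) ω - B s ω) * ψ u), ← h2, ← integral_add hint h1,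
      ← integral_const_mul]
    congr 1 with u
    simp only [hg]
    ring
  have hsubst : ∫ t, B t ω * ((2 : ℝ) ^ ((j : ℝ) / 2) * ψ (a * (t - s)))
      = (2 : ℝ) ^ ((j : ℝ) / 2) * (a⁻¹ * ∫ u, g u) := by
    have h1 : ∀ t, B t ω * ((2 : ℝ) ^ ((j : ℝ) / 2) * ψ (a * (t - s)))
        = (2 : ℝ) ^ ((j : ℝ) / 2) * g (a * (t - s)) := by
      intro t
      simp only [hg]
      rw [inv_mul_cancel_left₀ ha0.ne', add_sub_cancel]
      ring
    simp only [h1]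
    rw [integral_const_mul, integral_sub_right_eq_self (fun t => g (a * t)) s,
      Measure.integral_comp_mul_left, abs_of_pos (inv_pos.2 ha0), smul_eq_mul]
  rw [ndwtCoeff_zero_zero, hmain, ndwtCoeff, ← ha, hsubst, ← mul_assoc, ← mul_assoc]
  congr 1
  have h3 : a = (2 : ℝ) ^ (j : ℝ) := by rw [ha, Real.rpow_natCast]
  rw [h3, ← Real.rpow_neg two_pos.le, ← Real.rpow_mul two_pos.le, ← Real.rpow_add two_pos,
    ← Real.rpow_add two_pos]
  congr 1
  ring

/-- The wavelet coefficients of a fractional Brownian motion are centred Gaussian variables whose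
variance depends on the level only. -/
theorem IsFractionalBrownianMotion.hasLaw_ndwtCoeff (hB : IsFractionalBrownianMotion H B P)
    (hH : H ∈ Set.Ioo (0 : ℝ) 1) (hψ : Integrable ψ) (hψ' : Integrable fun t => t * ψ t)
    (hψ_zero : ∫ t, ψ t = 0) {σ : ℝ} (hσ : variance (ndwtCoeff ψ B 0 0) P = σ ^ 2) (j : ℕ)
    (s : ℝ) :
    HasLaw (ndwtCoeff ψ B j s) (gaussianReal 0 (levelScale H σ j).toNNReal) P := by
  have hV : ((fbmCoeffVariance H ψ).toNNReal : ℝ) = σ ^ 2 := by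
    rw [← hσ, (hB.ae_integrable_and_hasLaw hH hψ hψ').2.variance_eq, variance_id_gaussianReal]
  obtain ⟨hint, hlaw⟩ :=
    (hB.rescale hH.1 s (a := (2 : ℝ) ^ j) (by positivity)).ae_integrable_and_hasLaw hH hψ hψ'
  have hmul := gaussianReal_const_mul hlaw ((2 : ℝ) ^ (-((j : ℝ) / 2) - j * H))
  have hvar : NNReal.mk (((2 : ℝ) ^ (-((j : ℝ) / 2) - j * H)) ^ 2) (sq_nonneg _)
      * (fbmCoeffVariance H ψ).toNNReal = (levelScale H σ j).toNNReal := by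
    ext
    have hnn : 0 ≤ levelScale H σ j := by unfold levelScale; positivity
    rw [NNReal.coe_mul, hV, Real.coe_toNNReal _ hnn, levelScale, mul_comm]
    congr 1
    rw [NNReal.coe_mk, ← Real.rpow_natCast, ← Real.rpow_mul two_pos.le]
    congr 1
    push_cast
    ring
  rw [mul_zero, hvar] at hmul
  refine hmul.congr ?_
  filter_upwards [hint] with ω hω
  exact ndwtCoeff_eq_mul_rescale H hψ hψ_zero j s ω hω

end FractionalBrownianMotion

/-! ### Least squares slope and the error of the Hurst estimator. -/

section Regression

/-- The weights with which the observations enter the least squares slope. -/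
noncomputable def slopeWeight (J j : ℕ) : ℝ :=
  ((j : ℝ) - (∑ j ∈ Finset.Icc 1 J, (j : ℝ)) / J) /
    ∑ j ∈ Finset.Icc 1 J, ((j : ℝ) - (∑ j ∈ Finset.Icc 1 J, (j : ℝ)) / J) ^ 2

lemma sum_sub_mean (J : ℕ) :
    ∑ j ∈ Finset.Icc 1 J, ((j : ℝ) - (∑ j ∈ Finset.Icc 1 J, (j : ℝ)) / J) = 0 := by
  rcases Nat.eq_zero_or_pos J with rfl | hJ
  · simp
  have hJ0 : (J : ℝ) ≠ 0 := by exact_mod_cast hJ.ne'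
  rw [Finset.sum_sub_distrib, Finset.sum_const, Nat.card_Icc, nsmul_eq_mul, Nat.add_sub_cancel]
  field_simp
  ring

lemma regressionSlope_eq_sum (J : ℕ) (y : ℕ → ℝ) :
    regressionSlope J y = ∑ j ∈ Finset.Icc 1 J, slopeWeight J j * y j := by
  have h := sum_sub_mean J
  simp only [regressionSlope, slopeWeight, mul_sub, Finset.sum_sub_distrib, ← Finset.sum_mul]
  rw [Finset.sum_sub_distrib] at h
  rw [h, zero_mul, sub_zero, Finset.sum_div]
  exact Finset.sum_congr rfl fun j _ => (div_mul_eq_mul_div _ _ _).symm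

lemma sum_slopeWeight (J : ℕ) : ∑ j ∈ Finset.Icc 1 J, slopeWeight J j = 0 := by
  simp only [slopeWeight]
  rw [← Finset.sum_div, sum_sub_mean, zero_div]

lemma sum_slopeWeight_mul {J : ℕ} (hJ : 2 ≤ J) :
    ∑ j ∈ Finset.Icc 1 J, slopeWeight J j * j = 1 := by
  set x : ℝ := (∑ j ∈ Finset.Icc 1 J, (j : ℝ)) / J with hx
  have hD : 0 < ∑ j ∈ Finset.Icc 1 J, ((j : ℝ) - x) ^ 2 := by
    -- The mean cannot equal both $1$ and $2$, so the denominator of the slope is positive.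
    have hne : ((1 : ℕ) : ℝ) ≠ x ∨ ((2 : ℕ) : ℝ) ≠ x := by
      by_contra! h
      norm_num [← h.2] at h
    refine Finset.sum_pos' (fun _ _ => sq_nonneg _) ?_
    rcases hne with h | h
    · exact ⟨1, Finset.mem_Icc.2 ⟨le_rfl, by omega⟩, sq_pos_of_ne_zero (sub_ne_zero.2 h)⟩
    · exact ⟨2, Finset.mem_Icc.2 ⟨by omega, hJ⟩, sq_pos_of_ne_zero (sub_ne_zero.2 h)⟩
  have h0 := sum_sub_mean J
  rw [← hx] at h0
  have hnum : ∑ j ∈ Finset.Icc 1 J, ((j : ℝ) - x) * j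
      = ∑ j ∈ Finset.Icc 1 J, ((j : ℝ) - x) ^ 2 := by
    have : ∑ j ∈ Finset.Icc 1 J, ((j : ℝ) - x) * x = 0 := by
      rw [← Finset.sum_mul, h0, zero_mul]
    rw [← sub_zero (∑ j ∈ Finset.Icc 1 J, ((j : ℝ) - x) * j), ← this, ← Finset.sum_sub_distrib]
    exact Finset.sum_congr rfl fun j _ => by ring
  simp only [slopeWeight, ← hx, div_mul_eq_mul_div]
  rw [← Finset.sum_div, hnum, div_self hD.ne']

/-- The error of the estimator of the Hurst exponent in terms of the errors of the logarithms. -/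
lemma abs_hurstEstimator_sub_le {J M : ℕ} (hJ : 2 ≤ J) (hM : 1 ≤ M) {H σ c : ℝ} (hσ : 0 < σ)
    (hc : 0 < c) (m : ℕ → ℕ → ℝ) :
    |hurstEstimator J M m - H| ≤ ∑ i ∈ Finset.Icc 1 M, ∑ j ∈ Finset.Icc 1 J,
      |slopeWeight J j| / (2 * Real.log 2) / M *
        |Real.log (m j i) - Real.log (c * levelScale H σ j)| := by
  have hM0 : (0 : ℝ) < M := by exact_mod_cast hM
  have hl2 : 0 < Real.log 2 := Real.log_pos one_lt_two
  have hscale (j : ℕ) : Real.logb 2 (c * levelScale H σ j)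
      = Real.logb 2 (c * σ ^ 2) + -(2 * H + 1) * j := by
    rw [levelScale, ← mul_assoc, Real.logb_mul (by positivity) (by positivity),
      Real.logb_rpow two_pos (by norm_num)]
  -- The slope weights sum to zero, so $c\sigma^2$ drops out: the bias of the trimean as an
  -- estimator of $\lambda_j$ is harmless.
  have hslope : ∑ j ∈ Finset.Icc 1 J, slopeWeight J j * Real.logb 2 (c * levelScale H σ j)
      = -(2 * H + 1) := by
    simp only [hscale, mul_add, Finset.sum_add_distrib]
    rw [← Finset.sum_mul, sum_slopeWeight, zero_mul, zero_add]
    have : ∀ j : ℕ, slopeWeight J j * (-(2 * H + 1) * j)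
        = -(2 * H + 1) * (slopeWeight J j * j) := fun j => by ring
    simp only [this]
    rw [← Finset.mul_sum, sum_slopeWeight_mul hJ, mul_one]
  have herr : hurstEstimator J M m - H = ∑ i ∈ Finset.Icc 1 M, ∑ j ∈ Finset.Icc 1 J,
      -(slopeWeight J j / (2 * Real.log 2) / M *
        (Real.log (m j i) - Real.log (c * levelScale H σ j))) := by
    have h1 : ∀ i ∈ Finset.Icc 1 M, ∑ j ∈ Finset.Icc 1 J,
        -(slopeWeight J j / (2 * Real.log 2) / M *
          (Real.log (m j i) - Real.log (c * levelScale H σ j)))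
        = -(regressionSlope J (fun j => Real.logb 2 (m j i)) + (2 * H + 1)) / (2 * M) := by
      intro i _
      rw [regressionSlope_eq_sum, ← sub_neg_eq_add _ (2 * H + 1), ← hslope,
        ← Finset.sum_sub_distrib, ← Finset.sum_neg_distrib, Finset.sum_div]
      refine Finset.sum_congr rfl fun j _ => ?_
      simp only [Real.logb]
      field_simp
    rw [Finset.sum_congr rfl h1, hurstEstimator, ← Finset.sum_div, Finset.sum_neg_distrib,
      Finset.sum_add_distrib, Finset.sum_const, Nat.card_Icc, nsmul_eq_mul, Nat.add_sub_cancel]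
    field_simp
    ring
  rw [herr]
  refine (Finset.abs_sum_le_sum_abs _ _).trans (Finset.sum_le_sum fun i _ =>
    (Finset.abs_sum_le_sum_abs _ _).trans (Finset.sum_le_sum fun j _ => le_of_eq ?_))
  rw [abs_neg, abs_mul, abs_div, abs_div, abs_of_pos hM0, abs_of_pos (show 0 < 2 * Real.log 2 by
    positivity)]

end Regression

/-! ### Transfer to triangular arrays; consistency. -/

section Arrays

variable {Ω : ℕ → Type*} [∀ r, MeasurableSpace (Ω r)] {P : (r : ℕ) → Measure (Ω r)}
  {n : ℕ → ℕ} {α p s : ℝ}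

lemma generalTrimean_eq_mul_div {n : ℕ} (x : Fin n → ℝ) (hs : 0 < s) :
    generalTrimean α p x = s * generalTrimean α p fun l => x l / s := by
  rw [← generalTrimean_const_mul _ _ _ hs]
  congr 1 with l
  rw [mul_div_cancel₀ _ hs.ne']

/-- Asymptotic normality of the general trimean of a triangular array with independent,
exponentially distributed members in each row. -/
theorem tendstoInDistribution_generalTrimean_array [∀ r, IsProbabilityMeasure (P r)]
    (hn : Tendsto n atTop atTop)
    {G : (r : ℕ) → Fin (n r) → Ω r → ℝ} (hs : 0 < s)
    (hG : ∀ r, HasLaw (fun ω l => G r l ω / s) (Measure.pi fun _ => expMeasure 1) (P r))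
    (hα : α ∈ Set.Icc (0 : ℝ) 1) (hp : p ∈ Set.Ioc (0 : ℝ) (1 / 2))
    (hv : 0 < expTrimeanVariance α p) :
    TendstoInDistribution (fun r ω =>
      (generalTrimean α p (fun l => G r l ω) - expTrimean α p * s)
        / √(expTrimeanVariance α p / n r * s ^ 2)) atTop (id : ℝ → ℝ) P (gaussianReal 0 1) := by
  -- The law of a row's statistic depends only on the row length, so one i.i.d. sequence on an
  -- auxiliary space serves all rows, although they live on different spaces.
  obtain ⟨Ω', _, P', X, -, hlaw, hind, hP'⟩ := exists_iid ℕ (expMeasure 1)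
  set F : (n : ℕ) → (Fin n → ℝ) → ℝ := fun n x =>
    (generalTrimean α p x - expTrimean α p) / √(expTrimeanVariance α p / n) with hF
  have hFm (n : ℕ) : Measurable (F n) :=
    ((measurable_generalTrimean α p n).sub_const _).div_const _
  have hX (n : ℕ) : HasLaw (fun ω (l : Fin n) => X l ω) (Measure.pi fun _ => expMeasure 1) P' :=
    (hind.precomp (g := fun l : Fin n => (l : ℕ)) Fin.val_injective).hasLaw_pi fun l => hlaw l
  have hclt := tendstoInDistribution_generalTrimean hlaw hind hα hp hv
  have hfun : (fun r ω => (generalTrimean α p (fun l => G r l ω) - expTrimean α p * s)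
      / √(expTrimeanVariance α p / n r * s ^ 2))
      = fun (r : ℕ) ω => F (n r) fun l => G r l ω / s := by
    ext r ω
    simp only [hF]
    rw [generalTrimean_eq_mul_div _ hs, Real.sqrt_mul' _ (sq_nonneg s), Real.sqrt_sq hs.le,
      mul_comm s, ← sub_mul, mul_div_mul_right _ _ hs.ne']
  rw [hfun]
  have hmeas (r : ℕ) : AEMeasurable (fun ω => F (n r) fun l => G r l ω / s) (P r) :=
    (hFm _).comp_aemeasurable (hG r).aemeasurable
  refine ⟨hmeas, by fun_prop, ?_⟩
  refine (hclt.tendsto.comp hn).congr fun r => Subtype.ext ?_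
  change P'.map (F (n r) ∘ fun ω (l : Fin (n r)) => X l ω)
    = (P r).map (F (n r) ∘ fun ω l => G r l ω / s)
  rw [← AEMeasurable.map_map_of_aemeasurable (hFm _).aemeasurable (hX _).aemeasurable,
    ← AEMeasurable.map_map_of_aemeasurable (hFm _).aemeasurable (hG r).aemeasurable,
    (hX _).map_eq, (hG r).map_eq]

/-- The mean error of the logarithm of the general trimean of `n` independent standard exponential
variables. -/
noncomputable def logTrimeanError (α p : ℝ) (n : ℕ) : ENNReal :=
  ∫⁻ x : Fin n → ℝ, ENNReal.ofReal
    |Real.log (generalTrimean α p x) - Real.log (expTrimean α p)|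
    ∂(Measure.pi fun _ => expMeasure 1)

lemma measurable_ofReal_abs_log_generalTrimean_sub (n : ℕ) (c : ℝ) : Measurable
    fun x : Fin n → ℝ => ENNReal.ofReal |Real.log (generalTrimean α p x) - c| :=
  ENNReal.measurable_ofReal.comp (continuous_abs.measurable.comp
    ((Real.measurable_log.comp (measurable_generalTrimean α p n)).sub_const c))

lemma tendsto_logTrimeanError (hα : α ∈ Set.Icc (0 : ℝ) 1) (hp : p ∈ Set.Ioc (0 : ℝ) (1 / 2)) :
    Tendsto (logTrimeanError α p) atTop (𝓝 0) := by
  obtain ⟨Ω', _, P', X, -, hlaw, hind, hP'⟩ := exists_iid ℕ (expMeasure 1)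
  refine (tendsto_lintegral_abs_log_generalTrimean hlaw hind hα hp).congr fun n => ?_
  have hX : HasLaw (fun ω (l : Fin n) => X l ω) (Measure.pi fun _ => expMeasure 1) P' :=
    (hind.precomp (g := fun l : Fin n => (l : ℕ)) Fin.val_injective).hasLaw_pi fun l => hlaw l
  exact hX.lintegral_comp (measurable_ofReal_abs_log_generalTrimean_sub n _).aemeasurable

/-- Scaling becomes a shift of the logarithm that cancels, so the mean error depends on the sample
size alone, not on level or group. -/
lemma lintegral_abs_log_generalTrimean_sub {Ω : Type*} [MeasurableSpace Ω] {P : Measure Ω}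
    {n : ℕ} {G : Fin n → Ω → ℝ} (hs : 0 < s)
    (hG : HasLaw (fun ω l => G l ω / s) (Measure.pi fun _ => expMeasure 1) P)
    (hα : α ∈ Set.Icc (0 : ℝ) 1) (hp : p ∈ Set.Ioc (0 : ℝ) (1 / 2)) (hn : 1 ≤ n * (p / 2)) :
    ∫⁻ ω, ENNReal.ofReal |Real.log (generalTrimean α p fun l => G l ω)
      - Real.log (expTrimean α p * s)| ∂P = logTrimeanError α p n := by
  have hpos : ∀ᵐ x ∂(Measure.pi fun _ : Fin n => expMeasure 1), ∀ l, 0 < x l :=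
    ae_all_iff.2 fun l => (Measure.quasiMeasurePreserving_eval _ l).ae ae_pos_expMeasure
  have hpos' : ∀ᵐ ω ∂P, ∀ l, 0 < G l ω / s :=
    ae_of_ae_map (p := fun x : Fin n → ℝ => ∀ l, 0 < x l) hG.aemeasurable (hG.map_eq.symm ▸ hpos)
  rw [logTrimeanError, ← hG.lintegral_comp
    (measurable_ofReal_abs_log_generalTrimean_sub n _).aemeasurable]
  refine lintegral_congr_ae ?_
  filter_upwards [hpos'] with ω hω
  have hT := (abs_log_generalTrimean_le hα hp hn hω).1
  rw [generalTrimean_eq_mul_div _ hs, Real.log_mul hs.ne' hT.ne',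
    Real.log_mul (expTrimean_pos hα hp).ne' hs.ne']
  congr 2
  ring

/-- Consistency of the estimator of the Hurst exponent based on a general trimean. -/
theorem tendsto_measure_abs_hurstEstimator_sub (hn : Tendsto n atTop atTop) {J : ℕ} (hJ : 2 ≤ J)
    {M : ℕ → ℕ} (hM : ∀ r, 1 ≤ M r) {H σ : ℝ} (hσ : 0 < σ)
    {G : (r : ℕ) → ℕ → ℕ → Fin (n r) → Ω r → ℝ}
    (hG : ∀ r, ∀ j ∈ Finset.Icc 1 J, ∀ i ∈ Finset.Icc 1 (M r),
      HasLaw (fun ω l => G r j i l ω / levelScale H σ j) (Measure.pi fun _ => expMeasure 1) (P r))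
    (hα : α ∈ Set.Icc (0 : ℝ) 1) (hp : p ∈ Set.Ioc (0 : ℝ) (1 / 2)) {ε : ℝ} (hε : 0 < ε) :
    Tendsto (fun r => P r {ω | ε ≤ |hurstEstimator J (M r) (fun j i =>
      generalTrimean α p fun l => G r j i l ω) - H|}) atTop (𝓝 0) := by
  have hscale (j : ℕ) : 0 < levelScale H σ j := by unfold levelScale; positivity
  set e := logTrimeanError α p with he
  set w : ℕ → ℝ := fun j => |slopeWeight J j| / (2 * Real.log 2) with hw
  have hw0 (j : ℕ) : 0 ≤ w j := by
    have := Real.log_pos one_lt_two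
    positivity
  set K : ENNReal := ∑ j ∈ Finset.Icc 1 J, ENNReal.ofReal (w j) with hK
  have hbound : ∀ᶠ r in atTop, P r {ω | ε ≤ |hurstEstimator J (M r) (fun j i =>
      generalTrimean α p fun l => G r j i l ω) - H|} ≤ K * e (n r) / ENNReal.ofReal ε := by
    have hlarge : ∀ᶠ r in atTop, 1 ≤ (n r : ℝ) * (p / 2) := by
      filter_upwards [(tendsto_natCast_atTop_atTop.comp hn).eventually_ge_atTop (1 / (p / 2))]
        with r hr
      rwa [div_le_iff₀ (half_pos hp.1)] at hr
    filter_upwards [hlarge] with r hr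
    have hM0 : (0 : ℝ) < M r := by exact_mod_cast hM r
    set L : ℕ → ℕ → Ω r → ENNReal := fun i j ω => ENNReal.ofReal
      |Real.log (generalTrimean α p fun l => G r j i l ω)
        - Real.log (expTrimean α p * levelScale H σ j)| with hL
    have hLint (i j : ℕ) (hi : i ∈ Finset.Icc 1 (M r)) (hj : j ∈ Finset.Icc 1 J) :
        AEMeasurable (L i j) (P r) ∧ ∫⁻ ω, L i j ω ∂(P r) = e (n r) := by
      refine ⟨?_, lintegral_abs_log_generalTrimean_sub (hscale j) (hG r j hj i hi) hα hp hr⟩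
      have hGm : AEMeasurable (fun ω l => G r j i l ω) (P r) := by
        have := aemeasurable_pi_lambda _ fun l =>
          (aemeasurable_pi_iff.1 (hG r j hj i hi).aemeasurable l).mul_const (levelScale H σ j)
        simpa only [div_mul_cancel₀ _ (hscale j).ne'] using this
      exact (measurable_ofReal_abs_log_generalTrimean_sub (n r) _).comp_aemeasurable hGm
    set S : Ω r → ENNReal := fun ω => ∑ i ∈ Finset.Icc 1 (M r), ∑ j ∈ Finset.Icc 1 J,
      ENNReal.ofReal (w j / M r) * L i j ω with hS
    have hterm (i j : ℕ) (hi : i ∈ Finset.Icc 1 (M r)) (hj : j ∈ Finset.Icc 1 J) :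
        AEMeasurable (fun ω => ENNReal.ofReal (w j / M r) * L i j ω) (P r) :=
      (hLint i j hi hj).1.const_mul _
    have hSm : AEMeasurable S (P r) :=
      Finset.aemeasurable_fun_sum _ fun i hi => Finset.aemeasurable_fun_sum _ fun j hj =>
        hterm i j hi hj
    -- The $M$ equal group contributions cancel the weight $1/M$. Only linearity of the integral is
    -- used, so dependence between groups and growth of $M$ do not matter.
    have hSint : ∫⁻ ω, S ω ∂(P r) = K * e (n r) := by
      rw [lintegral_finsetSum' _ fun i hi => Finset.aemeasurable_fun_sum _ fun j hj =>
        hterm i j hi hj]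
      have hi' : ∀ i ∈ Finset.Icc 1 (M r), ∫⁻ ω, ∑ j ∈ Finset.Icc 1 J,
          ENNReal.ofReal (w j / M r) * L i j ω ∂(P r)
          = (∑ j ∈ Finset.Icc 1 J, ENNReal.ofReal (w j / M r)) * e (n r) := by
        intro i hi
        rw [lintegral_finsetSum' _ fun j hj => hterm i j hi hj, Finset.sum_mul]
        refine Finset.sum_congr rfl fun j hj => ?_
        rw [lintegral_const_mul'' _ (hLint i j hi hj).1, (hLint i j hi hj).2]
      rw [Finset.sum_congr rfl hi', Finset.sum_const, Nat.card_Icc, Nat.add_sub_cancel,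
        nsmul_eq_mul, ← mul_assoc, Finset.mul_sum]
      congr 1
      refine Finset.sum_congr rfl fun j _ => ?_
      rw [← ENNReal.ofReal_natCast, ← ENNReal.ofReal_mul hM0.le, mul_div_cancel₀ _ hM0.ne']
    rw [← hSint]
    refine (measure_mono ?_).trans (meas_ge_le_lintegral_div hSm
      (ENNReal.ofReal_pos.2 hε).ne' ENNReal.ofReal_ne_top)
    intro ω hω
    have h1 := abs_hurstEstimator_sub_le (H := H) hJ (hM r) hσ (expTrimean_pos hα hp)
      fun j i => generalTrimean α p fun l => G r j i l ω
    have h2 := ENNReal.ofReal_le_ofReal (hω.trans h1)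
    rw [ENNReal.ofReal_sum_of_nonneg fun i _ => Finset.sum_nonneg fun j _ => mul_nonneg
      (div_nonneg (hw0 j) hM0.le) (abs_nonneg _)] at h2
    refine h2.trans (Finset.sum_le_sum fun i _ => le_of_eq ?_)
    rw [ENNReal.ofReal_sum_of_nonneg fun j _ => mul_nonneg
      (div_nonneg (hw0 j) hM0.le) (abs_nonneg _)]
    exact Finset.sum_congr rfl fun j _ => ENNReal.ofReal_mul (div_nonneg (hw0 j) hM0.le)
  have hlim : Tendsto (fun r => K * e (n r) / ENNReal.ofReal ε) atTop (𝓝 0) := by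
    have hKtop : K ≠ ⊤ := ENNReal.sum_ne_top.2 fun j _ => ENNReal.ofReal_ne_top
    have h1 := ENNReal.Tendsto.const_mul ((tendsto_logTrimeanError hα hp).comp hn)
      (Or.inr hKtop)
    have h2 := ENNReal.Tendsto.div_const h1 (Or.inr (ENNReal.ofReal_pos.2 hε).ne')
    simpa using h2
  exact tendsto_of_tendsto_of_tendsto_of_le_of_le' tendsto_const_nhds hlim
    (Eventually.of_forall fun _ => zero_le) hbound

end Arrays

/-! ### Mid-energies as exponential samples; numerical constants. -/

section MidEnergies

/-- The normalized mid-energies of a group form an independent sample from the standard exponential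
distribution. -/
lemma hasLaw_midEnergyGroup_div {Ω : Type*} [MeasurableSpace Ω] {P : Measure Ω}
    [IsProbabilityMeasure P] {N M : ℕ} (hMN : 2 * M ∣ N) {d : ℕ → ℕ → Ω → ℝ} {j i : ℕ}
    (hi : i ∈ Finset.Icc 1 M) {v : ℝ} (hv : 0 < v)
    (hd : ∀ k ∈ Finset.Icc 1 N, HasLaw (d j k) (gaussianReal 0 v.toNNReal) P)
    (hpair : ∀ k ∈ Finset.Icc 1 (N / 2), IndepFun (d j k) (d j (k + N / 2)) P)
    (hgroup : iIndepFun (midEnergyGroup N M d j i) P) :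
    HasLaw (fun ω l => midEnergyGroup N M d j i l ω / v) (Measure.pi fun _ => expMeasure 1) P := by
  have hiM := Finset.mem_Icc.1 hi
  have hv' : v.toNNReal ≠ 0 := by simpa using hv
  refine (hgroup.comp (fun _ x => x / v) fun _ => by fun_prop).hasLaw_pi fun l => ?_
  obtain ⟨q, hq⟩ := hMN
  have hMpos : 0 < 2 * M := by omega
  have hl : (l : ℕ) < q := lt_of_lt_of_eq l.2 (by rw [hq, Nat.mul_div_cancel_left _ hMpos])
  have hN : N = M * q + M * q := by rw [hq]; ring
  -- Here $Mq=N/2$, so both indices of the mid-energy stay within $1,\dots,N$.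
  have hle : i + l * M ≤ M * q := by nlinarith
  have h2 := hasLaw_half_sq_add_sq hv'
    (hd (i + l * M) (Finset.mem_Icc.2 ⟨by omega, by omega⟩))
    (hd (i + l * M + N / 2) (Finset.mem_Icc.2 ⟨by omega, by omega⟩))
    (hpair (i + l * M) (Finset.mem_Icc.2 ⟨by omega, by omega⟩))
  rw [Real.coe_toNNReal _ hv.le] at h2
  exact h2

lemma div_natCast_div_two_mul {N M : ℕ} (hM : 1 ≤ M) (hMN : 2 * M ∣ N) (v : ℝ) :
    v / ((N / (2 * M) : ℕ) : ℝ) = 2 * v * M / N := by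
  have hM0 : (M : ℝ) ≠ 0 := by positivity
  rw [Nat.cast_div hMN (by positivity), div_div_eq_mul_div]
  push_cast
  ring

lemma expTrimean_tukey : expTrimean (1 / 2) (1 / 4) = 1 / 4 * Real.log (64 / 3) := by
  have h1 : Real.log (64 / 3) = -Real.log (1 - 1 / 4) + 2 * -Real.log (1 - 1 / 2)
      + -Real.log (1 - (1 - 1 / 4)) := by
    rw [← Real.log_inv, ← Real.log_inv, ← Real.log_inv, two_mul, ← Real.log_mul (by norm_num)
      (by norm_num), ← Real.log_mul (by norm_num) (by norm_num), ← Real.log_mul (by norm_num)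
      (by norm_num)]
    norm_num
  rw [h1, expTrimean]
  ring

lemma expTrimean_gastwirth :
    expTrimean 0.6 (1 / 3) = 0.3 * Real.log (9 / 2) + 0.4 * Real.log 2 := by
  have h1 : Real.log (9 / 2) = -Real.log (1 - 1 / 3) + -Real.log (1 - (1 - 1 / 3)) := by
    rw [← Real.log_inv, ← Real.log_inv, ← Real.log_mul (by norm_num) (by norm_num)]
    norm_num
  have h2 : Real.log 2 = -Real.log (1 - 1 / 2) := by
    rw [← Real.log_inv]
    norm_num
  rw [h1, h2, expTrimean]
  ring

lemma expTrimeanVariance_tukey : expTrimeanVariance (1 / 2) (1 / 4) = 5 / 6 := by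
  norm_num [expTrimeanVariance]

/-- The value is exact, so the constant $1.67=2\cdot0.835$ is not a rounding. -/
lemma expTrimeanVariance_gastwirth : expTrimeanVariance 0.6 (1 / 3) = 0.835 := by
  norm_num [expTrimeanVariance]

end MidEnergies

theorem lemma2
    -- a fractional Brownian motion and a wavelet
    {Ω₀ : Type*} [MeasurableSpace Ω₀] (Q : Measure Ω₀) [IsProbabilityMeasure Q]
    (H : ℝ) (hH : H ∈ Set.Ioo (0 : ℝ) 1)
    (B : ℝ → Ω₀ → ℝ) (hB : IsFractionalBrownianMotion H B Q)
    (ψ : ℝ → ℝ) (hψ : Integrable ψ) (hψ_moment : Integrable fun t => t * ψ t)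
    (hψ_zero : ∫ t, ψ t = 0)
    -- the standard deviation of the wavelet coefficients from level 0
    (σ : ℝ) (hσ : 0 < σ) (hσ_var : variance (ndwtCoeff ψ B 0 0) Q = σ ^ 2)
    -- number of levels, sample sizes, numbers of groups, grid steps
    (J : ℕ) (N M : ℕ → ℕ) (hM : ∀ r, 1 ≤ M r) (hMN : ∀ r, 2 * M r ∣ N r)
    (hlim : Tendsto (fun r => N r / (2 * M r)) atTop atTop) (δ : ℕ → ℝ)
    -- arrays of `N r` wavelet coefficients on each of the levels `1, …, J`
    {Ω : ℕ → Type*} [∀ r, MeasurableSpace (Ω r)] (P : (r : ℕ) → Measure (Ω r))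
    [∀ r, IsProbabilityMeasure (P r)]
    (d : (r : ℕ) → ℕ → ℕ → Ω r → ℝ)
    (hd_law : ∀ r, ∀ j ∈ Finset.Icc 1 J, ∀ k ∈ Finset.Icc 1 (N r),
      IdentDistrib (d r j k) (ndwtCoeff ψ B j (k * δ r)) (P r) Q)
    -- independence of the two coefficients in a mid-energy
    (hd_pair : ∀ r, ∀ j ∈ Finset.Icc 1 J, ∀ k ∈ Finset.Icc 1 (N r / 2),
      IndepFun (d r j k) (d r j (k + N r / 2)) (P r))
    -- independence of the mid-energies within each group
    (hd_group : ∀ r, ∀ j ∈ Finset.Icc 1 J, ∀ i ∈ Finset.Icc 1 (M r),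
      iIndepFun (midEnergyGroup (N r) (M r) (d r) j i) (P r)) :
    (∀ j ∈ Finset.Icc 1 J, ∀ i : ℕ → ℕ, (∀ r, i r ∈ Finset.Icc 1 (M r)) →
      TendstoInDistribution
        (fun r ω =>
          (tukeyTrimean (fun l => midEnergyGroup (N r) (M r) (d r) j (i r) l ω)
              - (1 / 4 * Real.log (64 / 3)) * levelScale H σ j)
            / √(5 * (M r : ℝ) / (3 * (N r : ℝ)) * levelScale H σ j ^ 2))
        atTop (id : ℝ → ℝ) P (gaussianReal 0 1) ∧
      TendstoInDistribution
        (fun r ω =>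
          (gastwirth (fun l => midEnergyGroup (N r) (M r) (d r) j (i r) l ω)
              - (0.3 * Real.log (9 / 2) + 0.4 * Real.log 2) * levelScale H σ j)
            / √(1.67 * (M r : ℝ) / (N r : ℝ) * levelScale H σ j ^ 2))
        atTop (id : ℝ → ℝ) P (gaussianReal 0 1)) ∧
    (2 ≤ J → ∀ ε : ℝ, 0 < ε →
      Tendsto (fun r => P r {ω | ε ≤ |hurstEstimator J (M r) (fun j i =>
        tukeyTrimean fun l => midEnergyGroup (N r) (M r) (d r) j i l ω) - H|}) atTop (𝓝 0) ∧
      Tendsto (fun r => P r {ω | ε ≤ |hurstEstimator J (M r) (fun j i =>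
        gastwirth fun l => midEnergyGroup (N r) (M r) (d r) j i l ω) - H|}) atTop (𝓝 0)) := by
  have hscale (j : ℕ) : 0 < levelScale H σ j := by unfold levelScale; positivity
  have hcoeff (j : ℕ) (s : ℝ) : HasLaw (ndwtCoeff ψ B j s)
      (gaussianReal 0 (levelScale H σ j).toNNReal) Q :=
    hB.hasLaw_ndwtCoeff hH hψ hψ_moment hψ_zero hσ_var j s
  have hgroup (r j i : ℕ) (hj : j ∈ Finset.Icc 1 J) (hi : i ∈ Finset.Icc 1 (M r)) :
      HasLaw (fun ω l => midEnergyGroup (N r) (M r) (d r) j i l ω / levelScale H σ j)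
        (Measure.pi fun _ => expMeasure 1) (P r) := by
    refine hasLaw_midEnergyGroup_div (hMN r) hi (hscale j) (fun k hk => ?_) (hd_pair r j hj)
      (hd_group r j hj i hi)
    have h := hd_law r j hj k hk
    exact ⟨h.aemeasurable_fst, by rw [h.map_eq, (hcoeff j _).map_eq]⟩
  have hvar (r : ℕ) (v : ℝ) := div_natCast_div_two_mul (hM r) (hMN r) v
  have hT (r : ℕ) : 2 * (5 / 6) * (M r : ℝ) / N r = 5 * M r / (3 * N r) := by ring
  have hG (r : ℕ) : 2 * 0.835 * (M r : ℝ) / N r = 1.67 * M r / N r := by ring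
  refine ⟨fun j hj i hi => ⟨?_, ?_⟩, fun hJ ε hε => ⟨?_, ?_⟩⟩
  · have h := tendstoInDistribution_generalTrimean_array hlim (hscale j)
      (fun r => hgroup r j (i r) hj (hi r)) (α := 1 / 2) (p := 1 / 4) (by norm_num) (by norm_num)
      (by rw [expTrimeanVariance_tukey]; norm_num)
    simp only [hvar, expTrimean_tukey, expTrimeanVariance_tukey, hT] at h
    exact h
  · have h := tendstoInDistribution_generalTrimean_array hlim (hscale j)
      (fun r => hgroup r j (i r) hj (hi r)) (α := 0.6) (p := 1 / 3) (by norm_num) (by norm_num)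
      (by rw [expTrimeanVariance_gastwirth]; norm_num)
    simp only [hvar, expTrimean_gastwirth, expTrimeanVariance_gastwirth, hG] at h
    exact h
  · exact tendsto_measure_abs_hurstEstimator_sub hlim hJ hM hσ
      (fun r j hj i hi => hgroup r j i hj hi) (α := 1 / 2) (p := 1 / 4) (by norm_num)
      (by norm_num) hε
  · exact tendsto_measure_abs_hurstEstimator_sub hlim hJ hM hσ
      (fun r j hj i hi => hgroup r j i hj hi) (α := 0.6) (p := 1 / 3) (by norm_num)
      (by norm_num) hε
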